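/- Let $K\ge 2$, let $\Delta_{K-1}=\{\theta\in\mathbb{R}^K:\theta_i\ge 0,\ \sum_i\theta_i=1\}$, and for $\eta\in(0,\infty)^K$ let $\mathrm{Dir}_\eta$ denote the Dirichlet distribution on $\Delta_{K-1}$, with density $\mathrm{Dir}_\eta(\theta)=B(\eta)^{-1}\prod_{i=1}^K\theta_i^{\eta_i-1}$, $B(\eta)=\prod_i\Gamma(\eta_i)/\Gamma(\sum_i\eta_i)$, with respect to Lebesgue measure in the first $K-1$ coordinates. Let $\alpha\in(0,\infty)^K$, let $H:\mathbb{R}^K\to\mathbb{R}\cup\{-\infty\}$ and let $\theta^*\in\Delta_{K-1}$. Assume: (A1) $\theta^*$ is the unique global maximizer of $H$ on $\Delta_{K-1}$; (A2) $H$ is continuous on $\Delta_{K-1}$ (as a function with values in $[-\infty,\infty)$), and finite and twice continuously differentiable in an open neighborhood of $\theta^*$ in $\mathbb{R}^K$; (A3) (strict complementarity) the Karush–Kuhn–Tucker multipliers at $\theta^*$, that is, $\mu\in\mathbb{R}$ and $\lambda_i\ge 0$ with $\lambda_i=0$ whenever $\theta_i^*>0$ and $\nabla H(\theta^*)=-\sum_i\lambda_ie_i+\mu\mathbf{1}$,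 satisfy $\lambda_i>0$ whenever $\theta^*_i=0$; (A4) $v^\top\nabla^2H(\theta^*)v<0$ for every $v\ne 0$ with $\sum_iv_i=0$ and $v_i=0$ whenever $\theta_i^*=0$. For real $n>0$ put $I(n)=\mathbb{E}_{\mathrm{Dir}_\alpha}[e^{nH(\theta)}]$ (with $e^{-\infty}=0$). Fix $N\ge 1$ and $0<\epsilon<\min_{i:\theta_i^*>0}\theta_i^*$, and let $\Delta_{K-1}^\epsilon=\{\theta\in\Delta_{K-1}:\theta_i\ge\epsilon\text{ for all }i\text{ with }\theta^*_i>0\}$. For $\gamma\in(0,1)$ the importance sampling estimator of $I(n)$ is $$\hat p_{\mathrm{IS}}^{\gamma}=\frac1N\sum_{j=1}^N e^{nH(\theta^{(j)})}\,\frac{\mathrm{Dir}_\alpha(\theta^{(j)})}{\mathrm{Dir}_{\alpha+n^\gamma\theta^*}(\theta^{(j)})}\,\mathbf{1}_{\Delta_{K-1}^\epsilon}(\theta^{(j)}),\qquad \theta^{(j)}\overset{\text{iid}}{\sim}\mathrm{Dir}_{\alpha+n^\gamma\theta^*},$$ and $\mathrm{MSE}(\hat p_{\mathrm{IS}}^{\gamma})=\mathbb{E}[(\hat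 p_{\mathrm{IS}}^{\gamma}-I(n))^2]$. Let $m$ be the number of zero components of $\theta^*$. Then for every $\gamma\in(0,1)$, as $n\to\infty$, $$\frac{\mathrm{MSE}(\hat p_{\mathrm{IS}}^{\gamma})}{I(n)^2}=\Theta\left(n^{(1-\gamma)\left(\frac{K-1-m}{2}+\sum_{i:\theta_i^*=0}\alpha_i\right)}\right).$$ Consequently the relative mean squared error can be brought arbitrarily close to being bounded: for every $\xi>0$ there is $\gamma_0\in(0,1)$ such that, for every $\gamma\in[\gamma_0,1)$, $\mathrm{MSE}(\hat p_{\mathrm{IS}}^{\gamma})/I(n)^2=O(n^{\xi})$ as $n\to\infty$. -/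

import Mathlib

open MeasureTheory ProbabilityTheory Filter Asymptotics

noncomputable section

/-- The multivariate Beta function `B(α) = ∏ Γ(αᵢ) / Γ(∑ αᵢ)`. -/
def multiBeta {d : ℕ} (α : Fin (d + 1) → ℝ) : ℝ :=
  (∏ i, Real.Gamma (α i)) / Real.Gamma (∑ i, α i)

/-- The Dirichlet density `Dir_α(θ) = B(α)⁻¹ ∏ θᵢ ^ (αᵢ - 1)`, as a function of the point `θ` of
the simplex with `K = d + 1` vertices. -/
def dirichletDensity {d : ℕ} (α θ : Fin (d + 1) → ℝ) : ℝ :=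
  1 / multiBeta α * ∏ i, θ i ^ (α i - 1)

/-- The projected simplex `{y ∈ ℝ^(K-1) : yᵢ ≥ 0, ∑ yᵢ ≤ 1}`, with `K - 1 = d`. -/
def projectedSimplex (d : ℕ) : Set (Fin d → ℝ) :=
  {y | (∀ i, 0 ≤ y i) ∧ ∑ i, y i ≤ 1}

/-- The coordinate map `T(y) = (y₁, …, y_(K-1), 1 - ∑ yᵢ)`. -/
def simplexCoord {d : ℕ} (y : Fin d → ℝ) : Fin (d + 1) → ℝ :=
  Fin.snoc (α := fun _ => ℝ) y (1 - ∑ i, y i)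

/-- The Dirichlet distribution with parameter `α`, as a measure on `ℝ^K` carried by the simplex:
in the first `K - 1` coordinates it has Lebesgue density `Dir_α` on the projected simplex. -/
def dirichletMeasure {d : ℕ} (α : Fin (d + 1) → ℝ) : Measure (Fin (d + 1) → ℝ) :=
  ((volume.restrict (projectedSimplex d)).withDensity
    (fun y => ENNReal.ofReal (dirichletDensity α (simplexCoord y)))).map simplexCoord

/-- `e^{n H(θ)}` for `H` with values in `ℝ ∪ {-∞}` and `n > 0`, where `e^{-∞} = 0`. -/
def expScaled {d : ℕ} (H : (Fin (d + 1) → ℝ) → EReal) (n : ℝ) (θ : Fin (d + 1) → ℝ) : ℝ :=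
  (EReal.exp ((n : EReal) * H θ)).toReal

/-- The estimand `I(n) = E_{Dir_α}[e^{n H(θ)}]`. -/
def estimand {d : ℕ} (H : (Fin (d + 1) → ℝ) → EReal) (α : Fin (d + 1) → ℝ) (n : ℝ) : ℝ :=
  ∫ θ, expScaled H n θ ∂(dirichletMeasure α)

/-- `(lam, μ)` are Karush–Kuhn–Tucker multipliers at `θs` for maximizing `h` over the simplex:
`∇h(θs) = -∑ lamᵢ eᵢ + μ 𝟏` with `lam ≥ 0` and `lamᵢ = 0` at the inactive constraints. -/
def IsKKTMultiplier {d : ℕ} (h : (Fin (d + 1) → ℝ) → ℝ) (θs lam : Fin (d + 1) → ℝ) (μ : ℝ) :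
    Prop :=
  (∀ i, 0 ≤ lam i) ∧ (∀ i, 0 < θs i → lam i = 0) ∧
    ∀ i, fderiv ℝ h θs (Pi.single i 1) = -lam i + μ

/-- The critical cone at `θs`: directions with zero sum that vanish where `θs` does. -/
def criticalCone {d : ℕ} (θs : Fin (d + 1) → ℝ) : Set (Fin (d + 1) → ℝ) :=
  {v | ∑ i, v i = 0 ∧ ∀ i, θs i = 0 → v i = 0}

/-- The standing assumptions on `H : ℝ^K → ℝ ∪ {-∞}` and its maximizer `θs`. -/
structure LaplaceAssumptions {d : ℕ} (H : (Fin (d + 1) → ℝ) → EReal) (θs : Fin (d + 1) → ℝ) :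
    Prop where
  ne_top : ∀ θ, H θ ≠ ⊤
  mem_simplex : θs ∈ stdSimplex ℝ (Fin (d + 1))
  /-- `θs` is the unique global maximizer of `H` on the simplex. -/
  unique_max : ∀ θ ∈ stdSimplex ℝ (Fin (d + 1)), θ ≠ θs → H θ < H θs
  /-- `H` is continuous on the simplex. -/
  continuousOn : ContinuousOn H (stdSimplex ℝ (Fin (d + 1)))
  /-- `H` is (finite and) twice continuously differentiable in a neighborhood of `θs` in `ℝ^K`. -/
  contDiff : ∃ U : Set (Fin (d + 1) → ℝ), IsOpen U ∧ θs ∈ U ∧ (∀ θ ∈ U, H θ ≠ ⊥) ∧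
    ContDiffOn ℝ 2 (fun θ => (H θ).toReal) U
  /-- Strict complementarity of the multipliers of the active constraints. -/
  strict_compl : ∀ (lam : Fin (d + 1) → ℝ) (μ : ℝ),
    IsKKTMultiplier (fun θ => (H θ).toReal) θs lam μ → ∀ i, θs i = 0 → 0 < lam i
  /-- The Hessian of `H` at `θs` is negative definite on the critical cone. -/
  neg_def : ∀ v ∈ criticalCone θs, v ≠ 0 →
    fderiv ℝ (fderiv ℝ (fun θ => (H θ).toReal)) θs v v < 0

/-- The simplex truncated at level `ε` in the coordinates in which `θs` is positive. -/
def truncatedSimplex {d : ℕ} (θs : Fin (d + 1) → ℝ) (ε : ℝ) : Set (Fin (d + 1) → ℝ) :=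
  {θ | θ ∈ stdSimplex ℝ (Fin (d + 1)) ∧ ∀ i, 0 < θs i → ε ≤ θ i}

/-- The parameter `α + n^γ θs` of the importance sampling distribution. -/
def isParam {d : ℕ} (α θs : Fin (d + 1) → ℝ) (γ n : ℝ) : Fin (d + 1) → ℝ :=
  fun i => α i + n ^ γ * θs i

open Classical in
/-- One importance sampling replication at the sample point `θ`:
`e^{n H(θ)} (Dir_α / Dir_{α + n^γ θs})(θ)` on the truncated simplex, `0` off it. -/
def isReplication {d : ℕ} (H : (Fin (d + 1) → ℝ) → EReal) (α θs : Fin (d + 1) → ℝ)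
    (ε γ n : ℝ) (θ : Fin (d + 1) → ℝ) : ℝ :=
  expScaled H n θ * (dirichletDensity α θ / dirichletDensity (isParam α θs γ n) θ) *
    (if θ ∈ truncatedSimplex θs ε then 1 else 0)

/-- The importance sampling estimator computed from the sample points `x₁, …, x_N`. -/
def isEstimator {d N : ℕ} (H : (Fin (d + 1) → ℝ) → EReal) (α θs : Fin (d + 1) → ℝ)
    (ε γ n : ℝ) (x : Fin N → Fin (d + 1) → ℝ) : ℝ :=
  1 / (N : ℝ) * ∑ i, isReplication H α θs ε γ n (x i)

/-- Mean squared error of the random variable `Z` as an estimator of `c`. -/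
def meanSquaredError {Ω : Type*} [MeasurableSpace Ω] (P : Measure Ω) (Z : Ω → ℝ) (c : ℝ) : ℝ :=
  ∫ ω, (Z ω - c) ^ 2 ∂P

open Classical in
/-- The number `m` of zero components. -/
def numZeros {d : ℕ} (θs : Fin (d + 1) → ℝ) : ℕ :=
  (Finset.univ.filter (fun i => θs i = 0)).card

open Classical in
/-- The sum of the `αᵢ` over the zero components of `θs`. -/
def zeroParamSum {d : ℕ} (α θs : Fin (d + 1) → ℝ) : ℝ :=
  ∑ i ∈ Finset.univ.filter (fun i => θs i = 0), α i

end

/-! Everything is compared with one model gap `g = simplexGap θs`, linear in the coordinates where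
`θs` vanishes and quadratic in the others. Its Laplace integral `∫ ∏ θᵢ^(αᵢ-1) e^{-s g}` is of exact
order `s^(-κ)`, with `κ = laplaceRate α θs`: a zero coordinate contributes a Gamma integral
`s^(-αᵢ)`, a positive one a Gaussian `s^(-1/2)`, and one factor `s^(-1/2)` is given back because the
coordinates sum to one (`exists_lintegral_simplexGap_le`, `exists_le_setLIntegral_simplexGap`).

Two functions are comparable with `g`. First, `H(θs) - H` is at least `c g` on the whole simplex and
at most `C g` near `θs`: strict complementarity gives the linear part, the Hessian condition the
quadratic part, and compactness the rest. Second, the relative entropy `D` of `θs` with respect to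
`θ` is at least `g / 4`, and at most a multiple of `g` on the truncated simplex.

Write `t = n^γ`, `β = α + t θs`, `w` for unnormalized densities. Then `w_β = e^{t ∑ θsᵢ log θsᵢ} w_α
e^{-tD}`, so `B(β)` is that constant prefactor times `Z(t) = ∫ w_α e^{-tD}`, of order `t^(-κ)`. In
the second moment of one replication, `B(β) / B(α)² ∫ e^{2nH} w_α² / w_β`, the prefactor cancels and
`B(α)^(-2) Z(t) ∫ w_α e^{2nH + tD}` remains, over the truncated simplex. As `γ < 1`, `tD` is
negligible against `n g`, so this is of order `n^(-γκ) e^{2nH(θs)} n^(-κ)`. Dividing by `I(n)²`, of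
order `e^{2nH(θs)} n^(-2κ)`, leaves `n^((1-γ)κ)`.

A replication has mean between `0` and `I(n)`, so bias and variance put the mean squared error
between `(q - I²) / N` and `q + I²`, where `q` is the second moment. Since `κ > 0`, `q` dominates
`I²`, which gives the Theta statement. The final claim takes `γ` so close to `1` that `(1-γ)κ ≤ ξ`.
-/

noncomputable section

/-! ### Lebesgue measure on the simplex and its symmetry -/

/-- The measure on `ℝ^K` carried by the simplex whose image in the first `K - 1` coordinates is
Lebesgue measure on the projected simplex. -/
def simplexMeasure (d : ℕ) : Measure (Fin (d + 1) → ℝ) :=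
  (volume.restrict (projectedSimplex d)).map simplexCoord

theorem simplexCoord_castSucc {d : ℕ} (y : Fin d → ℝ) (i : Fin d) :
    simplexCoord y i.castSucc = y i := by simp [simplexCoord]

theorem simplexCoord_last {d : ℕ} (y : Fin d → ℝ) :
    simplexCoord y (Fin.last d) = 1 - ∑ i, y i := by simp [simplexCoord]

theorem continuous_simplexCoord {d : ℕ} : Continuous (simplexCoord (d := d)) := by
  refine continuous_pi fun i => ?_
  induction i using Fin.lastCases with
  | last => simp only [simplexCoord_last]; fun_prop
  | cast i => simp only [simplexCoord_castSucc]; fun_prop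

theorem measurableSet_projectedSimplex (d : ℕ) : MeasurableSet (projectedSimplex d) := by
  have : projectedSimplex d = (⋂ i, {y | 0 ≤ y i}) ∩ {y | ∑ i, y i ≤ 1} := by
    ext y; simp [projectedSimplex]
  rw [this]
  refine (MeasurableSet.iInter fun i => ?_).inter ?_
  · exact (isClosed_le continuous_const (continuous_apply i)).measurableSet
  · exact (isClosed_le (by fun_prop) continuous_const).measurableSet

theorem simplexCoord_mem_stdSimplex {d : ℕ} {y : Fin d → ℝ} (hy : y ∈ projectedSimplex d) :
    simplexCoord y ∈ stdSimplex ℝ (Fin (d + 1)) := by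
  refine ⟨fun i => ?_, ?_⟩
  · induction i using Fin.lastCases with
    | last => rw [simplexCoord_last]; linarith [hy.2]
    | cast i => rw [simplexCoord_castSucc]; exact hy.1 i
  · rw [Fin.sum_univ_castSucc]
    simp [simplexCoord_castSucc, simplexCoord_last]

theorem ae_mem_stdSimplex (d : ℕ) :
    ∀ᵐ θ ∂(simplexMeasure d), θ ∈ stdSimplex ℝ (Fin (d + 1)) := by
  refine (ae_map_iff (p := fun θ => θ ∈ stdSimplex ℝ (Fin (d + 1)))
    continuous_simplexCoord.aemeasurable (isClosed_stdSimplex ℝ _).measurableSet).2 ?_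
  filter_upwards [ae_restrict_mem (measurableSet_projectedSimplex d)] with y hy
  exact simplexCoord_mem_stdSimplex hy

theorem exists_pos_of_mem_stdSimplex {d : ℕ} {θ : Fin (d + 1) → ℝ}
    (hθ : θ ∈ stdSimplex ℝ (Fin (d + 1))) : ∃ k, 0 < θ k := by
  by_contra! h
  have := Finset.sum_nonpos (s := Finset.univ) fun i _ => h i
  rw [hθ.2] at this
  linarith

/-- Replace the `j`-th coordinate of `y` by the remaining mass `1 - ∑ yᵢ`. -/
def swapWithRemainder {d : ℕ} (j : Fin d) (y : Fin d → ℝ) : Fin d → ℝ :=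
  Function.update y j (1 - ∑ i, y i)

/-- The linear part of `swapWithRemainder`. -/
def swapWithRemainderLinear {d : ℕ} (j : Fin d) : (Fin d → ℝ) →ₗ[ℝ] (Fin d → ℝ) where
  toFun y := Function.update y j (-∑ i, y i)
  map_add' x y := by
    ext i
    by_cases h : i = j
    · subst h; simp [Finset.sum_add_distrib]; ring
    · simp [h]
  map_smul' c y := by
    ext i
    by_cases h : i = j
    · subst h; simp [Finset.mul_sum]
    · simp [h]

theorem sum_update_eq {d : ℕ} (j : Fin d) (y : Fin d → ℝ) (b : ℝ) :
    ∑ i, Function.update y j b i = b + (∑ i, y i) - y j := by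
  rw [Finset.sum_update_of_mem (Finset.mem_univ j), Finset.sum_eq_add_sum_sdiff_singleton_of_mem
    (Finset.mem_univ j) y]
  ring

/-- The map is affine and its linear part is an involution, so the determinant is `±1`; the
translation part is harmless. This is what makes the choice of the omitted coordinate immaterial. -/
theorem measurePreserving_swapWithRemainder {d : ℕ} (j : Fin d) :
    MeasurePreserving (swapWithRemainder j) := by
  have hinv : swapWithRemainderLinear j ∘ₗ swapWithRemainderLinear j = LinearMap.id := by
    refine LinearMap.ext fun y => ?_
    ext k
    simp only [swapWithRemainderLinear, LinearMap.comp_apply, LinearMap.coe_mk, AddHom.coe_mk,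
      sum_update_eq]
    by_cases h : k = j
    · subst h; simp
    · simp [h]
  have hdet : LinearMap.det (swapWithRemainderLinear j) *
      LinearMap.det (swapWithRemainderLinear j) = 1 := by
    rw [← LinearMap.det_comp, hinv, LinearMap.det_id]
  have habs : |(LinearMap.det (swapWithRemainderLinear j))⁻¹| = 1 := by
    rcases mul_self_eq_one_iff.1 hdet with h | h <;> simp [h]
  have hlin : MeasurePreserving (swapWithRemainderLinear j) := by
    refine ⟨(LinearMap.continuous_of_finiteDimensional _).measurable, ?_⟩
    rw [Real.map_linearMap_volume_pi_eq_smul_volume_pi (left_ne_zero_of_mul_eq_one hdet), habs]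
    simp
  have h := (measurePreserving_add_right volume (Pi.single j (1 : ℝ) : Fin d → ℝ)).comp hlin
  have heq : (swapWithRemainder j : (Fin d → ℝ) → Fin d → ℝ) =
      (fun x => x + Pi.single j 1) ∘ swapWithRemainderLinear j := by
    refine funext fun y => funext fun k => ?_
    by_cases hk : k = j
    · subst hk; simp [swapWithRemainder, swapWithRemainderLinear]; ring
    · simp [swapWithRemainder, swapWithRemainderLinear, hk]
  rw [heq]
  exact h

theorem simplexCoord_swapWithRemainder {d : ℕ} (j : Fin d) (y : Fin d → ℝ) :
    simplexCoord (swapWithRemainder j y) =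
      simplexCoord y ∘ Equiv.swap j.castSucc (Fin.last d) := by
  ext i
  induction i using Fin.lastCases with
  | last =>
    simp [simplexCoord_last, swapWithRemainder, sum_update_eq, simplexCoord_castSucc]
  | cast i =>
    by_cases h : i = j
    · subst h
      simp [simplexCoord_castSucc, swapWithRemainder, simplexCoord_last]
    · have h1 : i.castSucc ≠ j.castSucc := fun h' => h (Fin.castSucc_injective _ h')
      simp [simplexCoord_castSucc, swapWithRemainder, h,
        Equiv.swap_apply_of_ne_of_ne h1 (Fin.castSucc_lt_last i).ne]

theorem swapWithRemainder_preimage {d : ℕ} (j : Fin d) :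
    swapWithRemainder j ⁻¹' projectedSimplex d = projectedSimplex d := by
  have key : ∀ y ∈ projectedSimplex d, swapWithRemainder j y ∈ projectedSimplex d := by
    intro y hy
    refine ⟨fun i => ?_, ?_⟩
    · by_cases h : i = j
      · subst h; simpa [swapWithRemainder] using hy.2
      · simpa [swapWithRemainder, h] using hy.1 i
    · simp only [swapWithRemainder, sum_update_eq]
      linarith [hy.1 j]
  ext y
  refine ⟨fun h => ?_, key y⟩
  have h2 := key _ h
  convert h2 using 1
  ext k
  by_cases hk : k = j
  · subst hk; simp [swapWithRemainder, sum_update_eq]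
  · simp [swapWithRemainder, hk]

/-- The simplex measure is invariant under exchanging a coordinate with the last one. -/
theorem measurePreserving_swap_last {d : ℕ} (k : Fin (d + 1)) :
    MeasurePreserving (fun θ : Fin (d + 1) → ℝ => θ ∘ Equiv.swap k (Fin.last d))
      (simplexMeasure d) (simplexMeasure d) := by
  have hm : Measurable (fun θ : Fin (d + 1) → ℝ => θ ∘ Equiv.swap k (Fin.last d)) :=
    measurable_pi_lambda _ fun i => measurable_pi_apply _
  refine ⟨hm, ?_⟩
  induction k using Fin.lastCases with
  | last => simp
  | cast j =>
    have h := (measurePreserving_swapWithRemainder j).restrict_preimage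
      (measurableSet_projectedSimplex d)
    rw [swapWithRemainder_preimage] at h
    rw [simplexMeasure, Measure.map_map hm continuous_simplexCoord.measurable]
    have : (fun θ : Fin (d + 1) → ℝ => θ ∘ Equiv.swap j.castSucc (Fin.last d)) ∘ simplexCoord =
        simplexCoord ∘ swapWithRemainder j := by
      ext1 y; simp [simplexCoord_swapWithRemainder]
    rw [this, ← Measure.map_map continuous_simplexCoord.measurable h.measurable, h.map_eq]

/-- Hyperplanes `yᵢ = 0` are null; the last coordinate is reduced to another one by symmetry.
Positivity legitimizes logarithms and the division by Dirichlet densities later on. -/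
theorem ae_simplexCoord_pos {d : ℕ} (hd : 1 ≤ d) :
    ∀ᵐ θ ∂(simplexMeasure d), ∀ i, 0 < θ i := by
  have hcast : ∀ i : Fin d, ∀ᵐ θ ∂(simplexMeasure d), θ i.castSucc ≠ 0 := by
    intro i
    refine (ae_map_iff (p := fun θ => θ i.castSucc ≠ 0) continuous_simplexCoord.aemeasurable
      (measurableSet_eq_fun (measurable_pi_apply _) measurable_const).compl).2 ?_
    simp only [simplexCoord_castSucc]
    exact ae_restrict_of_ae (Measure.ae_eval_ne (fun _ : Fin d => (volume : Measure ℝ)) i 0)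
  have hlast : ∀ᵐ θ ∂(simplexMeasure d), θ (Fin.last d) ≠ 0 := by
    have := (measurePreserving_swap_last
      (Fin.castSucc ⟨0, hd⟩ : Fin (d + 1))).quasiMeasurePreserving.ae (hcast ⟨0, hd⟩)
    filter_upwards [this] with θ h
    simpa using h
  filter_upwards [ae_mem_stdSimplex d, ae_all_iff.2 hcast, hlast] with θ h1 h2 h3 i
  refine lt_of_le_of_ne (h1.1 i) (Ne.symm ?_)
  induction i using Fin.lastCases with
  | last => exact h3
  | cast i => exact h2 i

/-! ### The model integrand -/

/-- The unnormalized Dirichlet density. -/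
def dirichletWeight {d : ℕ} (α θ : Fin (d + 1) → ℝ) : ℝ := ∏ i, θ i ^ (α i - 1)

/-- The decay of the log-likelihood in one coordinate: linear at an active constraint `p = 0`,
quadratic otherwise. -/
def coordGap (p x : ℝ) : ℝ := if p = 0 then x else (x - p) ^ 2

/-- The model decay `∑_{θsᵢ = 0} θᵢ + ∑_{θsᵢ ≠ 0} (θᵢ - θsᵢ)²`. -/
def simplexGap {d : ℕ} (θs θ : Fin (d + 1) → ℝ) : ℝ := ∑ i, coordGap (θs i) (θ i)

/-- The polynomial rate contributed by one coordinate. -/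
def coordRate (a p : ℝ) : ℝ := if p = 0 then a else 1 / 2

theorem coordGap_nonneg {p x : ℝ} (hx : 0 ≤ x) : 0 ≤ coordGap p x := by
  unfold coordGap; split_ifs <;> positivity

theorem simplexGap_nonneg {d : ℕ} {θs θ : Fin (d + 1) → ℝ} (hθ : ∀ i, 0 ≤ θ i) :
    0 ≤ simplexGap θs θ := Finset.sum_nonneg fun i _ => coordGap_nonneg (hθ i)

theorem dirichletWeight_nonneg {d : ℕ} {α θ : Fin (d + 1) → ℝ} (hθ : ∀ i, 0 ≤ θ i) :
    0 ≤ dirichletWeight α θ := Finset.prod_nonneg fun i _ => Real.rpow_nonneg (hθ i) _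

theorem continuous_coordGap (p : ℝ) : Continuous (coordGap p) := by
  unfold coordGap; split_ifs <;> fun_prop

theorem continuous_simplexGap {d : ℕ} (θs : Fin (d + 1) → ℝ) : Continuous (simplexGap θs) :=
  continuous_finsetSum _ fun i _ => (continuous_coordGap _).comp (continuous_apply i)

theorem measurable_dirichletWeight {d : ℕ} (α : Fin (d + 1) → ℝ) :
    Measurable (dirichletWeight α) := by
  unfold dirichletWeight
  exact Finset.measurable_fun_prod _ fun i _ => (measurable_pi_apply i).pow_const _

theorem measurable_dirichletWeight_mul_exp {d : ℕ} (α θs : Fin (d + 1) → ℝ) (s : ℝ) :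
    Measurable fun θ => dirichletWeight α θ * Real.exp (-(s * simplexGap θs θ)) :=
  (measurable_dirichletWeight α).mul
    ((continuous_simplexGap θs).measurable.const_mul s).neg.exp

/-! ### Upper bounds in one coordinate -/

/-- Exponentials decay faster than any power, uniformly on `[1, ∞)`. -/
theorem exists_exp_neg_mul_le_rpow {c : ℝ} (hc : 0 < c) (b : ℝ) :
    ∃ C, 0 < C ∧ ∀ s : ℝ, 1 ≤ s → Real.exp (-(c * s)) ≤ C * s ^ (-b) := by
  have hev : ∃ s₀ : ℝ, ∀ s ≥ s₀, Real.exp (-(c * s)) ≤ s ^ (-b) := by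
    have h' := (isLittleO_exp_neg_mul_rpow_atTop hc (-b)).def one_pos
    obtain ⟨s₀, hs₀⟩ := eventually_atTop.1 (h'.and (eventually_gt_atTop 0))
    refine ⟨s₀, fun s hs => ?_⟩
    have := (hs₀ s hs).1
    rw [Real.norm_of_nonneg (Real.exp_pos _).le,
      Real.norm_of_nonneg (Real.rpow_nonneg (hs₀ s hs).2.le _)] at this
    simpa [neg_mul] using this
  obtain ⟨s₀, hs₀⟩ := hev
  set S := max s₀ 1
  have hS : 1 ≤ S := le_max_right _ _
  refine ⟨max 1 (S ^ |b|), lt_of_lt_of_le one_pos (le_max_left _ _), fun s hs => ?_⟩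
  have hsp : 0 < s ^ (-b) := Real.rpow_pos_of_pos (by linarith) _
  by_cases hsS : s₀ ≤ s
  · calc _ ≤ s ^ (-b) := hs₀ s hsS
      _ ≤ _ := le_mul_of_one_le_left hsp.le (le_max_left _ _)
  · have h1 : Real.exp (-(c * s)) ≤ 1 := by
      rw [Real.exp_le_one_iff]; nlinarith
    have h2 : (1 : ℝ) ≤ S ^ |b| * s ^ (-b) := by
      calc (1 : ℝ) = s ^ b * s ^ (-b) := by
            rw [← Real.rpow_add (by linarith)]; simp
        _ ≤ S ^ |b| * s ^ (-b) := by
            gcongr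
            calc s ^ b ≤ s ^ |b| := Real.rpow_le_rpow_of_exponent_le hs (le_abs_self b)
              _ ≤ S ^ |b| := Real.rpow_le_rpow (by linarith)
                  (le_trans (not_le.1 hsS).le (le_max_left _ _)) (abs_nonneg b)
    exact h1.trans (h2.trans (by gcongr; exact le_max_right _ _))

theorem integrableOn_rpow_sub_one_Icc {a : ℝ} (ha : 0 < a) :
    IntegrableOn (fun x : ℝ => x ^ (a - 1)) (Set.Icc 0 1) := by
  have := intervalIntegral.intervalIntegrable_rpow' (a := 0) (b := 1) (r := a - 1) (by linarith)
  rw [intervalIntegrable_iff_integrableOn_Icc_of_le zero_le_one] at this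
  exact this

/-- On an interval bounded away from zero, powers are bounded above and below. -/
theorem exists_rpow_bounds {l u : ℝ} (hl : 0 < l) (b : ℝ) :
    ∃ c C, 0 < c ∧ 0 < C ∧ ∀ x ∈ Set.Icc l u, c ≤ x ^ b ∧ x ^ b ≤ C := by
  by_cases hlu : l ≤ u
  · have hu : 0 < u := hl.trans_le hlu
    refine ⟨min (l ^ b) (u ^ b), max (l ^ b) (u ^ b), ?_, ?_, fun x hx => ?_⟩
    · exact lt_min (Real.rpow_pos_of_pos hl _) (Real.rpow_pos_of_pos hu _)
    · exact lt_max_of_lt_left (Real.rpow_pos_of_pos hl _)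
    · have hx0 : 0 < x := hl.trans_le hx.1
      rcases le_total 0 b with hb | hb
      · exact ⟨(min_le_left _ _).trans (Real.rpow_le_rpow hl.le hx.1 hb),
          (Real.rpow_le_rpow hx0.le hx.2 hb).trans (le_max_right _ _)⟩
      · exact ⟨(min_le_right _ _).trans (Real.rpow_le_rpow_of_nonpos hx0 hx.2 hb),
          (Real.rpow_le_rpow_of_nonpos hl hx.1 hb).trans (le_max_left _ _)⟩
  · exact ⟨1, 1, one_pos, one_pos, fun x hx => absurd (hx.1.trans hx.2) hlu⟩

/-- For `p = 0` the integral is dominated by a Gamma integral. For `p > 0`, split at `p / 2`: above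
it the power is bounded and a Gaussian integral remains; below it the gap is at least `p² / 4`, and
exponential decay beats `s^(-1/2)` while the possible singularity of the power at `0` stays
integrable. -/
theorem exists_integral_coord_le {a p : ℝ} (ha : 0 < a) (hp : 0 ≤ p) :
    ∃ C, 0 < C ∧ ∀ s : ℝ, 1 ≤ s →
      IntegrableOn (fun x : ℝ => x ^ (a - 1) * Real.exp (-(s * coordGap p x))) (Set.Icc 0 1) ∧
      ∫ x in Set.Icc (0 : ℝ) 1, x ^ (a - 1) * Real.exp (-(s * coordGap p x)) ≤
        C * s ^ (-coordRate a p) := by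
  have hint : ∀ s : ℝ, 1 ≤ s →
      IntegrableOn (fun x : ℝ => x ^ (a - 1) * Real.exp (-(s * coordGap p x))) (Set.Icc 0 1) := by
    intro s hs
    refine (integrableOn_rpow_sub_one_Icc ha).mono' ?_ ?_
    · exact ((measurable_id.pow_const _).mul
        ((continuous_coordGap p).measurable.const_mul s).neg.exp).aestronglyMeasurable
    · refine (ae_restrict_mem measurableSet_Icc).mono fun x hx => ?_
      rw [Real.norm_of_nonneg (mul_nonneg (Real.rpow_nonneg hx.1 _) (Real.exp_pos _).le)]
      refine mul_le_of_le_one_right (Real.rpow_nonneg hx.1 _) (Real.exp_le_one_iff.2 ?_)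
      have := coordGap_nonneg (p := p) hx.1
      nlinarith
  rcases hp.eq_or_lt with rfl | hp
  · refine ⟨Real.Gamma a, Real.Gamma_pos_of_pos ha, fun s hs => ⟨hint s hs, ?_⟩⟩
    have hs0 : 0 < s := by linarith
    have hG := Real.integral_rpow_mul_exp_neg_mul_Ioi ha hs0
    have hGi : IntegrableOn (fun x : ℝ => x ^ (a - 1) * Real.exp (-(s * x))) (Set.Ioi 0) := by
      refine Integrable.of_integral_ne_zero ?_
      rw [hG]
      have := Real.Gamma_pos_of_pos ha
      positivity
    simp only [coordGap, coordRate, if_true]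
    rw [integral_Icc_eq_integral_Ioc]
    calc _ ≤ ∫ x in Set.Ioi (0 : ℝ), x ^ (a - 1) * Real.exp (-(s * x)) := by
          refine setIntegral_mono_set hGi ?_ (Eventually.of_forall Set.Ioc_subset_Ioi_self)
          refine (ae_restrict_mem measurableSet_Ioi).mono fun x hx => ?_
          exact mul_nonneg (Real.rpow_nonneg (le_of_lt hx) _) (Real.exp_pos _).le
      _ = _ := by
          rw [hG, one_div, Real.inv_rpow hs0.le, ← Real.rpow_neg hs0.le, mul_comm]
  · obtain ⟨_, C₁, _, hC₁, hb⟩ := exists_rpow_bounds (u := 1) (half_pos hp) (a - 1)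
    obtain ⟨C₂, hC₂, hE⟩ := exists_exp_neg_mul_le_rpow (c := p ^ 2 / 4) (by positivity) (1 / 2)
    have hI : 0 ≤ ∫ x in Set.Icc (0 : ℝ) 1, x ^ (a - 1) :=
      setIntegral_nonneg measurableSet_Icc fun x hx => Real.rpow_nonneg hx.1 _
    refine ⟨C₁ * Real.sqrt Real.pi + C₂ * ∫ x in Set.Icc (0 : ℝ) 1, x ^ (a - 1),
      by positivity, fun s hs => ⟨hint s hs, ?_⟩⟩
    have hs0 : 0 < s := by linarith
    have hg : Integrable fun x : ℝ => Real.exp (-s * (x - p) ^ 2) :=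
      (integrable_exp_neg_mul_sq hs0).comp_sub_right p
    simp only [coordGap, coordRate, hp.ne', if_false]
    calc _ ≤ ∫ x in Set.Icc (0 : ℝ) 1, (C₁ * Real.exp (-s * (x - p) ^ 2) +
            C₂ * s ^ (-(1 / 2) : ℝ) * x ^ (a - 1)) := by
          have h1 := hint s hs
          simp only [coordGap, hp.ne', if_false] at h1
          refine setIntegral_mono_on h1 ((hg.const_mul _).integrableOn.add
            ((integrableOn_rpow_sub_one_Icc ha).const_mul _)) measurableSet_Icc fun x hx => ?_
          have hx1 := Real.rpow_nonneg hx.1 (a - 1)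
          by_cases hxp : p / 2 ≤ x
          · have : x ^ (a - 1) * Real.exp (-(s * (x - p) ^ 2)) ≤
                C₁ * Real.exp (-s * (x - p) ^ 2) := by
              rw [neg_mul]
              gcongr
              exact (hb x ⟨hxp, hx.2⟩).2
            have : 0 ≤ C₂ * s ^ (-(1 / 2) : ℝ) * x ^ (a - 1) := by positivity
            linarith
          · have : x ^ (a - 1) * Real.exp (-(s * (x - p) ^ 2)) ≤
                x ^ (a - 1) * (C₂ * s ^ (-(1 / 2) : ℝ)) := by
              gcongr
              refine le_trans (Real.exp_le_exp.2 ?_) (hE s hs)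
              have : p ^ 2 / 4 ≤ (x - p) ^ 2 := by nlinarith
              nlinarith
            have : 0 ≤ C₁ * Real.exp (-s * (x - p) ^ 2) := by positivity
            linarith
      _ = C₁ * (∫ x in Set.Icc (0 : ℝ) 1, Real.exp (-s * (x - p) ^ 2)) +
            C₂ * s ^ (-(1 / 2) : ℝ) * ∫ x in Set.Icc (0 : ℝ) 1, x ^ (a - 1) := by
          rw [integral_add (hg.const_mul _).integrableOn
            ((integrableOn_rpow_sub_one_Icc ha).const_mul _), integral_const_mul,
            integral_const_mul]
      _ ≤ C₁ * (Real.sqrt Real.pi * s ^ (-(1 / 2) : ℝ)) +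
            C₂ * s ^ (-(1 / 2) : ℝ) * ∫ x in Set.Icc (0 : ℝ) 1, x ^ (a - 1) := by
          gcongr
          calc _ ≤ ∫ x : ℝ, Real.exp (-s * (x - p) ^ 2) :=
                setIntegral_le_integral hg (Eventually.of_forall fun x => (Real.exp_pos _).le)
            _ = Real.sqrt (Real.pi / s) := by
                rw [integral_sub_right_eq_self (fun x => Real.exp (-s * x ^ 2)) p,
                  integral_gaussian]
            _ = _ := by
                rw [Real.sqrt_div Real.pi_pos.le, Real.rpow_neg hs0.le, ← Real.sqrt_eq_rpow,
                  div_eq_mul_inv]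
      _ = _ := by ring

/-- A pointwise bound for the coordinate that is not integrated over. Its exponent is the usual rate
less the missing `1/2`: zero if `p ≠ 0`, and if `p = 0` any power is available, since `x ≥ l` makes
the factor exponentially small. -/
theorem exists_coord_le (a p : ℝ) {l : ℝ} (hl : 0 < l) :
    ∃ C, 0 < C ∧ ∀ s : ℝ, 1 ≤ s → ∀ x ∈ Set.Icc l 1,
      x ^ (a - 1) * Real.exp (-(s * coordGap p x)) ≤ C * s ^ (1 / 2 - coordRate a p) := by
  obtain ⟨_, C₁, _, hC₁, hb⟩ := exists_rpow_bounds (u := 1) hl (a - 1)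
  by_cases hp : p = 0
  · subst hp
    obtain ⟨C₂, hC₂, hE⟩ := exists_exp_neg_mul_le_rpow hl (a - 1 / 2)
    refine ⟨C₁ * C₂, by positivity, fun s hs x hx => ?_⟩
    simp only [coordGap, coordRate, if_true]
    rw [mul_assoc]
    refine mul_le_mul (hb x hx).2 ?_ (Real.exp_pos _).le hC₁.le
    have := hE s hs
    rw [neg_sub] at this
    refine le_trans (Real.exp_le_exp.2 ?_) this
    nlinarith [hx.1]
  · refine ⟨C₁, hC₁, fun s hs x hx => ?_⟩
    simp only [coordGap, coordRate, hp, if_false, sub_self, Real.rpow_zero]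
    refine mul_le_mul (hb x hx).2 (Real.exp_le_one_iff.2 ?_) (Real.exp_pos _).le hC₁.le
    nlinarith [sq_nonneg (x - p)]

/-! ### Upper Laplace bound on the simplex -/

theorem simplexGap_comp {d : ℕ} (e : Equiv.Perm (Fin (d + 1))) (θs θ : Fin (d + 1) → ℝ) :
    simplexGap (θs ∘ e) (θ ∘ e) = simplexGap θs θ :=
  Equiv.sum_comp e fun i => coordGap (θs i) (θ i)

theorem dirichletWeight_comp {d : ℕ} (e : Equiv.Perm (Fin (d + 1))) (α θ : Fin (d + 1) → ℝ) :
    dirichletWeight (α ∘ e) (θ ∘ e) = dirichletWeight α θ :=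
  Equiv.prod_comp e fun i => θ i ^ (α i - 1)

theorem dirichletWeight_mul_exp_eq_prod {d : ℕ} (α θs θ : Fin (d + 1) → ℝ) (s : ℝ) :
    dirichletWeight α θ * Real.exp (-(s * simplexGap θs θ)) =
      ∏ i, θ i ^ (α i - 1) * Real.exp (-(s * coordGap (θs i) (θ i))) := by
  rw [dirichletWeight, simplexGap, Finset.mul_sum, ← Finset.sum_neg_distrib, Real.exp_sum,
    ← Finset.prod_mul_distrib]

theorem prod_rpow_coordRate {d : ℕ} (α θs : Fin (d + 1) → ℝ) {s : ℝ} (hs : 0 < s) :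
    (∏ i : Fin d, s ^ (-coordRate (α i.castSucc) (θs i.castSucc))) *
      s ^ (1 / 2 - coordRate (α (Fin.last d)) (θs (Fin.last d))) =
    s ^ (1 / 2 - ∑ i, coordRate (α i) (θs i)) := by
  rw [← Real.rpow_sum_of_pos hs, ← Real.rpow_add hs, Fin.sum_univ_castSucc,
    Finset.sum_neg_distrib]
  congr 1; ring

theorem lintegral_ofReal_prod_indicator {d : ℕ} {f : Fin d → ℝ → ℝ} {S : Fin d → Set ℝ}
    (hS : ∀ i, MeasurableSet (S i)) (hf : ∀ i, IntegrableOn (f i) (S i))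
    (h0 : ∀ i, ∀ x ∈ S i, 0 ≤ f i x) {C : ℝ} (hC : 0 ≤ C) :
    ∫⁻ y : Fin d → ℝ, ENNReal.ofReal (C * ∏ i, (S i).indicator (f i) (y i)) =
      ENNReal.ofReal (C * ∏ i, ∫ x in S i, f i x) := by
  have hi : ∀ i, Integrable ((S i).indicator (f i)) := fun i =>
    (integrable_indicator_iff (hS i)).2 (hf i)
  rw [← ofReal_integral_eq_lintegral_ofReal, integral_const_mul,
    integral_fintype_prod_volume_eq_prod]
  · simp_rw [integral_indicator (hS _)]
  · exact (Integrable.fintype_prod hi).const_mul C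
  · exact Eventually.of_forall fun y => mul_nonneg hC (Finset.prod_nonneg fun i _ =>
      Set.indicator_nonneg (h0 i) _)

/-- Where the last coordinate is at least `l` its factor is bounded pointwise. The constraint `∑ yᵢ
≤ 1` is then dropped, enlarging the domain to the cube, so that the integral factors over the first
`d` coordinates. -/
theorem exists_setLIntegral_last_le {d : ℕ} (α θs : Fin (d + 1) → ℝ) (hα : ∀ i, 0 < α i)
    (hθs : ∀ i, 0 ≤ θs i) {l : ℝ} (hl : 0 < l) :
    ∃ C, 0 < C ∧ ∀ s : ℝ, 1 ≤ s →
      ∫⁻ θ in {θ | l ≤ θ (Fin.last d)},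
        ENNReal.ofReal (dirichletWeight α θ * Real.exp (-(s * simplexGap θs θ)))
          ∂(simplexMeasure d) ≤
        ENNReal.ofReal (C * s ^ (1 / 2 - ∑ i, coordRate (α i) (θs i))) := by
  choose C hC hCb using fun i : Fin d =>
    exists_integral_coord_le (hα i.castSucc) (hθs i.castSucc)
  obtain ⟨C', hC', hC'b⟩ := exists_coord_le (α (Fin.last d)) (θs (Fin.last d)) hl
  refine ⟨C' * ∏ i, C i, mul_pos hC' (Finset.prod_pos fun i _ => hC i), fun s hs => ?_⟩
  have hs0 : 0 < s := by linarith
  have hSm : MeasurableSet {θ : Fin (d + 1) → ℝ | l ≤ θ (Fin.last d)} :=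
    measurableSet_le measurable_const (measurable_pi_apply _)
  set f : Fin d → ℝ → ℝ := fun i x =>
    x ^ (α i.castSucc - 1) * Real.exp (-(s * coordGap (θs i.castSucc) x)) with hf
  set B := C' * s ^ (1 / 2 - coordRate (α (Fin.last d)) (θs (Fin.last d))) with hB
  have hB0 : 0 ≤ B := by positivity
  rw [simplexMeasure, setLIntegral_map hSm
    (measurable_dirichletWeight_mul_exp α θs s).ennreal_ofReal continuous_simplexCoord.measurable]
  have hSm' := continuous_simplexCoord.measurable hSm
  rw [Measure.restrict_restrict hSm']
  calc _ ≤ ∫⁻ y : Fin d → ℝ, ENNReal.ofReal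
          (B * ∏ i, (Set.Icc (0 : ℝ) 1).indicator (f i) (y i)) := by
        rw [← lintegral_indicator (hSm'.inter (measurableSet_projectedSimplex d))]
        refine lintegral_mono (Set.indicator_le ?_)
        rintro y ⟨hy1, hy2⟩
        have hmem := simplexCoord_mem_stdSimplex hy2
        have hle : ∀ i, simplexCoord y i ∈ Set.Icc (0 : ℝ) 1 := fun i =>
          ⟨hmem.1 i, hmem.2 ▸ Finset.single_le_sum (fun j _ => hmem.1 j) (Finset.mem_univ i)⟩
        refine ENNReal.ofReal_le_ofReal ?_
        rw [dirichletWeight_mul_exp_eq_prod, Fin.prod_univ_castSucc, mul_comm]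
        refine mul_le_mul (hC'b s hs _ ⟨hy1, (hle _).2⟩) (le_of_eq ?_) ?_ hB0
        · refine Finset.prod_congr rfl fun i _ => ?_
          have := hle i.castSucc
          rw [simplexCoord_castSucc] at this ⊢
          rw [Set.indicator_of_mem this]
        · exact Finset.prod_nonneg fun i _ =>
            mul_nonneg (Real.rpow_nonneg (hle _).1 _) (Real.exp_pos _).le
    _ = ENNReal.ofReal (B * ∏ i, ∫ x in Set.Icc (0 : ℝ) 1, f i x) :=
        lintegral_ofReal_prod_indicator (fun _ => measurableSet_Icc) (fun i => (hCb i s hs).1)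
          (fun i x hx => mul_nonneg (Real.rpow_nonneg hx.1 _) (Real.exp_pos _).le) hB0
    _ ≤ _ := by
        refine ENNReal.ofReal_le_ofReal ?_
        calc _ ≤ B * ∏ i, (C i * s ^ (-coordRate (α i.castSucc) (θs i.castSucc))) := by
              gcongr with i
              · exact fun i _ => setIntegral_nonneg measurableSet_Icc fun x hx =>
                  mul_nonneg (Real.rpow_nonneg hx.1 _) (Real.exp_pos _).le
              · exact (hCb i s hs).2
          _ = _ := by
              rw [← prod_rpow_coordRate α θs hs0, Finset.prod_mul_distrib, hB]; ring

/-- Upper Laplace bound for the model integrand over the whole simplex. -/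
theorem exists_lintegral_simplexGap_le {d : ℕ} (α θs : Fin (d + 1) → ℝ) (hα : ∀ i, 0 < α i)
    (hθs : ∀ i, 0 ≤ θs i) :
    ∃ C, 0 < C ∧ ∀ s : ℝ, 1 ≤ s →
      ∫⁻ θ, ENNReal.ofReal (dirichletWeight α θ * Real.exp (-(s * simplexGap θs θ)))
          ∂(simplexMeasure d) ≤
        ENNReal.ofReal (C * s ^ (1 / 2 - ∑ i, coordRate (α i) (θs i))) := by
  -- Some coordinate of a point of the simplex is at least the average `1 / (d + 1)`; the pieces so
  -- obtained are exchanged into the last position by symmetry.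
  have hl : (0 : ℝ) < 1 / (d + 1) := by positivity
  choose C hC hCb using fun k : Fin (d + 1) =>
    exists_setLIntegral_last_le (α ∘ Equiv.swap k (Fin.last d)) (θs ∘ Equiv.swap k (Fin.last d))
      (fun i => hα _) (fun i => hθs _) hl
  refine ⟨∑ k, C k, Finset.sum_pos (fun k _ => hC k) ⟨0, Finset.mem_univ _⟩, fun s hs => ?_⟩
  have hs0 : 0 < s := by linarith
  set F : (Fin (d + 1) → ℝ) → ENNReal := fun θ =>
    ENNReal.ofReal (dirichletWeight α θ * Real.exp (-(s * simplexGap θs θ))) with hF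
  have hcover : ∀ᵐ θ ∂(simplexMeasure d),
      θ ∈ ⋃ k, {θ : Fin (d + 1) → ℝ | 1 / ((d : ℝ) + 1) ≤ θ k} := by
    filter_upwards [ae_mem_stdSimplex d] with θ hθ
    simp only [Set.mem_iUnion, Set.mem_ofPred_eq]
    by_contra! h
    have : ∑ k, θ k < ∑ _k : Fin (d + 1), 1 / ((d : ℝ) + 1) :=
      Finset.sum_lt_sum_of_nonempty ⟨0, Finset.mem_univ _⟩ fun k _ => h k
    rw [hθ.2, Finset.sum_const, Finset.card_univ, Fintype.card_fin, nsmul_eq_mul] at this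
    push_cast at this
    rw [mul_one_div_cancel (by positivity)] at this
    exact lt_irrefl _ this
  have hpart : ∀ k, ∫⁻ θ in {θ | 1 / ((d : ℝ) + 1) ≤ θ k}, F θ ∂(simplexMeasure d) ≤
      ENNReal.ofReal (C k * s ^ (1 / 2 - ∑ i, coordRate (α i) (θs i))) := by
    intro k
    have h := hCb k s hs
    have hsum : ∑ i, coordRate ((α ∘ Equiv.swap k (Fin.last d)) i)
        ((θs ∘ Equiv.swap k (Fin.last d)) i) = ∑ i, coordRate (α i) (θs i) :=
      Equiv.sum_comp (Equiv.swap k (Fin.last d)) fun i => coordRate (α i) (θs i)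
    rw [hsum] at h
    refine le_trans (le_of_eq ?_) h
    have hmp := measurePreserving_swap_last k
    conv_rhs => rw [← hmp.map_eq]
    rw [setLIntegral_map (measurableSet_le measurable_const (measurable_pi_apply _))
      (measurable_dirichletWeight_mul_exp _ _ s).ennreal_ofReal hmp.measurable]
    simp only [simplexGap_comp, dirichletWeight_comp, hF]
    congr 2
    ext θ
    simp
  calc ∫⁻ θ, F θ ∂(simplexMeasure d)
      = ∫⁻ θ in ⋃ k, {θ : Fin (d + 1) → ℝ | 1 / ((d : ℝ) + 1) ≤ θ k}, F θ
          ∂(simplexMeasure d) := by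
        rw [Measure.restrict_eq_self_of_ae_mem hcover]
    _ ≤ ∑' k, ∫⁻ θ in {θ : Fin (d + 1) → ℝ | 1 / ((d : ℝ) + 1) ≤ θ k}, F θ
          ∂(simplexMeasure d) := lintegral_iUnion_le _ _
    _ ≤ ∑ k, ENNReal.ofReal (C k * s ^ (1 / 2 - ∑ i, coordRate (α i) (θs i))) := by
        rw [tsum_fintype]; exact Finset.sum_le_sum fun k _ => hpart k
    _ = _ := by
        rw [← ENNReal.ofReal_sum_of_nonneg fun k _ => by have := hC k; positivity,
          Finset.sum_mul]

/-! ### Lower Laplace bound near the maximizer -/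

/-- The width of the Laplace window in one coordinate. -/
def coordWidth (p s : ℝ) : ℝ := if p = 0 then s⁻¹ else s ^ (-(1 / 2) : ℝ)

theorem coordWidth_pos (p : ℝ) {s : ℝ} (hs : 0 < s) : 0 < coordWidth p s := by
  unfold coordWidth; split_ifs <;> positivity

theorem coordWidth_le (p : ℝ) {s : ℝ} (hs : 1 ≤ s) : coordWidth p s ≤ s ^ (-(1 / 2) : ℝ) := by
  unfold coordWidth
  split_ifs
  · rw [← Real.rpow_neg_one]
    exact Real.rpow_le_rpow_of_exponent_le hs (by norm_num)
  · exact le_rfl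

theorem rpow_neg_half_le_one {s : ℝ} (hs : 1 ≤ s) : s ^ (-(1 / 2) : ℝ) ≤ 1 :=
  Real.rpow_le_one_of_one_le_of_nonpos hs (by norm_num)

theorem mul_rpow_neg_half_sq {s : ℝ} (hs : 0 < s) : s * (s ^ (-(1 / 2) : ℝ)) ^ 2 = 1 := by
  rw [← Real.rpow_natCast, ← Real.rpow_mul hs.le]
  norm_num
  rw [Real.rpow_neg_one, mul_inv_cancel₀ hs.ne']

theorem mul_coordGap_le {p s δ x : ℝ} (hs : 1 ≤ s) (hδ1 : δ ≤ 1)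
    (hx : x ∈ Set.Ioc p (p + δ * coordWidth p s)) : s * coordGap p x ≤ 1 := by
  have hs0 : 0 < s := by linarith
  by_cases hp : p = 0
  · subst hp
    simp only [coordGap, coordWidth, if_true, zero_add] at hx ⊢
    calc s * x ≤ s * (δ * s⁻¹) := by gcongr; exact hx.2
      _ = δ := by field_simp
      _ ≤ 1 := hδ1
  · simp only [coordGap, coordWidth, hp, if_false] at hx ⊢
    rw [← mul_rpow_neg_half_sq hs0]
    have : 0 < s ^ (-(1 / 2) : ℝ) := by positivity
    have h0 : 0 ≤ x - p := by linarith [hx.1]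
    have h1 : x - p ≤ s ^ (-(1 / 2) : ℝ) := by nlinarith [hx.2]
    gcongr

/-- The window lies to the right of `p`, hence in the positive half-line. At `p = 0` the integral is
explicit; at `p > 0` the power is bounded below and the window length supplies `s^(-1/2)`. -/
theorem exists_le_integral_coord {a p δ : ℝ} (ha : 0 < a) (hp : 0 ≤ p) (hδ : 0 < δ)
    (hδ1 : δ ≤ 1) :
    ∃ c, 0 < c ∧ ∀ s : ℝ, 1 ≤ s →
      IntegrableOn (fun x : ℝ => x ^ (a - 1)) (Set.Ioc p (p + δ * coordWidth p s)) ∧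
      c * s ^ (-coordRate a p) ≤ ∫ x in Set.Ioc p (p + δ * coordWidth p s), x ^ (a - 1) := by
  have hint : ∀ s : ℝ, 1 ≤ s →
      IntegrableOn (fun x : ℝ => x ^ (a - 1)) (Set.Ioc p (p + δ * coordWidth p s)) := by
    intro s hs
    have := coordWidth_pos p (show 0 < s by linarith)
    rw [← intervalIntegrable_iff_integrableOn_Ioc_of_le (by nlinarith)]
    exact intervalIntegral.intervalIntegrable_rpow' (by linarith)
  rcases hp.eq_or_lt with rfl | hp
  · refine ⟨δ ^ a / a, by positivity, fun s hs => ⟨hint s hs, ?_⟩⟩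
    have hs0 : 0 < s := by linarith
    simp only [coordWidth, coordRate, if_true, zero_add]
    rw [← intervalIntegral.integral_of_le (by positivity), integral_rpow (Or.inl (by linarith)),
      sub_add_cancel, Real.zero_rpow ha.ne', sub_zero, Real.mul_rpow hδ.le (by positivity),
      Real.inv_rpow hs0.le, Real.rpow_neg hs0.le]
    exact le_of_eq (by ring)
  · obtain ⟨c, _, hc, _, hb⟩ := exists_rpow_bounds (u := p + 1) hp (a - 1)
    refine ⟨c * δ, by positivity, fun s hs => ⟨hint s hs, ?_⟩⟩
    have hw := coordWidth_pos p (show 0 < s by linarith)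
    have hw1 : coordWidth p s ≤ 1 := (coordWidth_le p hs).trans (rpow_neg_half_le_one hs)
    have hsub : ∀ x ∈ Set.Ioc p (p + δ * coordWidth p s), c ≤ x ^ (a - 1) := fun x hx =>
      (hb x ⟨hx.1.le, by nlinarith [hx.2]⟩).1
    have h := setIntegral_mono_on (μ := volume) (f := fun _ => c) (by simp) (hint s hs)
      measurableSet_Ioc hsub
    rw [setIntegral_const, smul_eq_mul, Real.volume_real_Ioc_of_le (by nlinarith)] at h
    refine le_trans (le_of_eq ?_) h
    simp only [coordWidth, coordRate, hp.ne', if_false]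
    ring

/-- Restrict to the box of windows in the first `d` coordinates. The last coordinate, positive at
`θs`, absorbs the change: there `s * simplexGap` stays bounded, so the exponential is bounded below
and the integral factors. -/
theorem exists_le_setLIntegral_last {d : ℕ} (α θs : Fin (d + 1) → ℝ) (hα : ∀ i, 0 < α i)
    (hθs : θs ∈ stdSimplex ℝ (Fin (d + 1))) (hlast : 0 < θs (Fin.last d)) {r : ℝ} (hr : 0 < r) :
    ∃ c, 0 < c ∧ ∀ s : ℝ, 1 ≤ s →
      ENNReal.ofReal (c * s ^ (1 / 2 - ∑ i, coordRate (α i) (θs i))) ≤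
      ∫⁻ θ in Metric.ball θs r,
        ENNReal.ofReal (dirichletWeight α θ * Real.exp (-(s * simplexGap θs θ)))
          ∂(simplexMeasure d) := by
  set q := θs (Fin.last d) with hq
  -- `d * δ ≤ q / 2` keeps the last coordinate above `q / 2`, and `(d + 1) * δ < r` keeps the box
  -- inside the ball.
  obtain ⟨δ, hδ, hδ1, hδq, hδr⟩ : ∃ δ : ℝ, 0 < δ ∧ δ ≤ 1 ∧ d * δ ≤ q / 2 ∧ (d + 1) * δ < r := by
    refine ⟨min 1 (min (q / 2) (r / 2) / (d + 1)), by positivity, min_le_left _ _, ?_, ?_⟩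
    · have h1 : min 1 (min (q / 2) (r / 2) / ((d : ℝ) + 1)) ≤ (q / 2) / (d + 1) :=
        (min_le_right _ _).trans (by gcongr; exact min_le_left _ _)
      rw [le_div_iff₀ (by positivity)] at h1
      have : 0 < min 1 (min (q / 2) (r / 2) / ((d : ℝ) + 1)) := by positivity
      linarith
    · have h1 : min 1 (min (q / 2) (r / 2) / ((d : ℝ) + 1)) ≤ (r / 2) / (d + 1) :=
        (min_le_right _ _).trans (by gcongr; exact min_le_right _ _)
      rw [le_div_iff₀ (by positivity)] at h1
      linarith
  choose c hc hcb using fun i : Fin d =>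
    exists_le_integral_coord (hα i.castSucc) (hθs.1 i.castSucc) hδ hδ1
  obtain ⟨c', _, hc', _, hb⟩ := exists_rpow_bounds (u := 1) (half_pos hlast) (α (Fin.last d) - 1)
  -- Each of the first `d` coordinates adds at most `1` to `s * simplexGap`; the last one, displaced
  -- by at most `d * s^(-1/2)`, adds at most `d²`.
  set E := Real.exp (-(d + (d : ℝ) ^ 2)) with hE
  refine ⟨c' * E * ∏ i, c i, mul_pos (by positivity) (Finset.prod_pos fun i _ => hc i),
    fun s hs => ?_⟩
  have hs0 : 0 < s := by linarith
  set u := s ^ (-(1 / 2) : ℝ) with hu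
  have hu0 : 0 < u := by positivity
  have hu1 : u ≤ 1 := rpow_neg_half_le_one hs
  have hSm : MeasurableSet (Metric.ball θs r) := Metric.isOpen_ball.measurableSet
  rw [simplexMeasure, setLIntegral_map hSm
    (measurable_dirichletWeight_mul_exp α θs s).ennreal_ofReal continuous_simplexCoord.measurable]
  have hSm' := continuous_simplexCoord.measurable hSm
  rw [Measure.restrict_restrict hSm', ← lintegral_indicator
    (hSm'.inter (measurableSet_projectedSimplex d))]
  set S : Fin d → Set ℝ := fun i =>
    Set.Ioc (θs i.castSucc) (θs i.castSucc + δ * coordWidth (θs i.castSucc) s) with hS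
  set f : Fin d → ℝ → ℝ := fun i x => x ^ (α i.castSucc - 1) with hf
  have hf0 : ∀ i, ∀ x ∈ S i, 0 ≤ f i x := fun i x hx =>
    Real.rpow_nonneg ((hθs.1 i.castSucc).trans hx.1.le) _
  calc _ ≤ ENNReal.ofReal (c' * E * ∏ i, ∫ x in S i, f i x) := by
        refine ENNReal.ofReal_le_ofReal ?_
        calc _ = c' * E * ∏ i, (c i * s ^ (-coordRate (α i.castSucc) (θs i.castSucc))) := by
              rw [← prod_rpow_coordRate α θs hs0, Finset.prod_mul_distrib]
              simp only [coordRate, hlast.ne', ← hq, if_false, sub_self, Real.rpow_zero]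
              ring
          _ ≤ _ := by
              refine mul_le_mul_of_nonneg_left ?_ (by positivity)
              refine Finset.prod_le_prod (fun i _ => ?_) fun i _ => (hcb i s hs).2
              have := hc i
              positivity
    _ = ∫⁻ y : Fin d → ℝ, ENNReal.ofReal (c' * E * ∏ i, (S i).indicator (f i) (y i)) :=
        (lintegral_ofReal_prod_indicator (fun _ => measurableSet_Ioc) (fun i => (hcb i s hs).1)
          hf0 (by positivity)).symm
    _ ≤ _ := by
        refine lintegral_mono fun y => ?_
        by_cases hy : ∀ i, y i ∈ S i
        swap
        · obtain ⟨i, hi⟩ := not_forall.1 hy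
          have : ∏ i, (S i).indicator (f i) (y i) = 0 :=
            Finset.prod_eq_zero (Finset.mem_univ i) (Set.indicator_of_notMem hi _)
          simp [this]
        have hlow : ∀ i, 0 ≤ y i - θs i.castSucc := fun i => by linarith [(hy i).1]
        have hupp : ∀ i, y i - θs i.castSucc ≤ δ * u := fun i => by
          have h1 := (hy i).2
          have h2 := mul_le_mul_of_nonneg_left (coordWidth_le (θs i.castSucc) hs) hδ.le
          linarith
        have hsum : simplexCoord y (Fin.last d) = q - ∑ i, (y i - θs i.castSucc) := by
          have h1 := hθs.2
          rw [Fin.sum_univ_castSucc] at h1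
          rw [simplexCoord_last, Finset.sum_sub_distrib]
          linarith
        have hs1 : 0 ≤ ∑ i, (y i - θs i.castSucc) := Finset.sum_nonneg fun i _ => hlow i
        have hs2 : ∑ i, (y i - θs i.castSucc) ≤ d * δ * u := by
          calc _ ≤ ∑ _i : Fin d, δ * u := Finset.sum_le_sum fun i _ => hupp i
            _ = _ := by simp [mul_assoc]
        have hdδ : 0 ≤ d * δ := by positivity
        have hs3 : d * δ * u ≤ d * δ := mul_le_of_le_one_right hdδ hu1
        have hq1 : q ≤ 1 :=
          hθs.2 ▸ Finset.single_le_sum (fun j _ => hθs.1 j) (Finset.mem_univ (Fin.last d))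
        have hlastmem : simplexCoord y (Fin.last d) ∈ Set.Icc (q / 2) 1 := by
          rw [hsum]; constructor <;> linarith
        have hmem : y ∈ simplexCoord ⁻¹' Metric.ball θs r ∩ projectedSimplex d := by
          refine ⟨?_, fun i => ?_, ?_⟩
          · refine (dist_pi_lt_iff hr).2 fun i => ?_
            rw [Real.dist_eq]
            induction i using Fin.lastCases with
            | last =>
              rw [hsum, sub_sub_cancel_left, abs_neg, abs_of_nonneg hs1]
              linarith
            | cast i =>
              rw [simplexCoord_castSucc, abs_of_nonneg (hlow i)]
              have := hupp i
              have : δ * u ≤ δ := mul_le_of_le_one_right hδ.le hu1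
              linarith
          · linarith [hlow i, hθs.1 i.castSucc]
          · have := hlastmem.1
            rw [simplexCoord_last] at this
            linarith
        rw [Set.indicator_of_mem hmem]
        refine ENNReal.ofReal_le_ofReal ?_
        have hgap : s * simplexGap θs (simplexCoord y) ≤ d + (d : ℝ) ^ 2 := by
          rw [simplexGap, Fin.sum_univ_castSucc, mul_add, Finset.mul_sum]
          refine add_le_add ?_ ?_
          · calc _ ≤ ∑ _i : Fin d, (1 : ℝ) := Finset.sum_le_sum fun i _ => by
                  rw [simplexCoord_castSucc]
                  exact mul_coordGap_le hs hδ1 (hy i)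
              _ = d := by simp
          · rw [coordGap, if_neg hlast.ne', hsum, ← hq, sub_sub_cancel_left, neg_sq]
            calc s * (∑ i, (y i - θs i.castSucc)) ^ 2 ≤ s * (d * u) ^ 2 := by
                  gcongr
                  refine hs2.trans ?_
                  gcongr
                  exact mul_le_of_le_one_right (by positivity) hδ1
              _ = d ^ 2 * (s * u ^ 2) := by ring
              _ = _ := by rw [hu, mul_rpow_neg_half_sq hs0, mul_one]
        have hw : dirichletWeight α (simplexCoord y) =
            simplexCoord y (Fin.last d) ^ (α (Fin.last d) - 1) *
              ∏ i, (S i).indicator (f i) (y i) := by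
          rw [dirichletWeight, Fin.prod_univ_castSucc, mul_comm]
          congr 1
          refine Finset.prod_congr rfl fun i _ => ?_
          rw [Set.indicator_of_mem (hy i), simplexCoord_castSucc]
        have hP : 0 ≤ ∏ i, (S i).indicator (f i) (y i) :=
          Finset.prod_nonneg fun i _ => Set.indicator_nonneg (hf0 i) _
        rw [hw, mul_right_comm _ _ (Real.exp (-(s * simplexGap θs (simplexCoord y))))]
        refine mul_le_mul_of_nonneg_right ?_ hP
        refine mul_le_mul (hb _ hlastmem).1 (Real.exp_le_exp.2 (neg_le_neg hgap))
          (Real.exp_pos _).le (Real.rpow_nonneg ?_ _)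
        linarith [hlastmem.1]

/-- Lower Laplace bound for the model integrand, localized near `θs`. -/
theorem exists_le_setLIntegral_simplexGap {d : ℕ} (α θs : Fin (d + 1) → ℝ) (hα : ∀ i, 0 < α i)
    (hθs : θs ∈ stdSimplex ℝ (Fin (d + 1))) {r : ℝ} (hr : 0 < r) :
    ∃ c, 0 < c ∧ ∀ s : ℝ, 1 ≤ s →
      ENNReal.ofReal (c * s ^ (1 / 2 - ∑ i, coordRate (α i) (θs i))) ≤
      ∫⁻ θ in Metric.ball θs r,
        ENNReal.ofReal (dirichletWeight α θ * Real.exp (-(s * simplexGap θs θ)))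
          ∂(simplexMeasure d) := by
  obtain ⟨k, hk⟩ := exists_pos_of_mem_stdSimplex hθs
  set e := Equiv.swap k (Fin.last d) with he
  obtain ⟨c, hc, hcb⟩ := exists_le_setLIntegral_last (α ∘ e) (θs ∘ e)
    (fun i => hα _) ⟨fun i => hθs.1 _, (Equiv.sum_comp e θs).trans hθs.2⟩ (by simpa [he]) hr
  refine ⟨c, hc, fun s hs => ?_⟩
  have h := hcb s hs
  have hsum : ∑ i, coordRate ((α ∘ e) i) ((θs ∘ e) i) = ∑ i, coordRate (α i) (θs i) :=
    Equiv.sum_comp e fun i => coordRate (α i) (θs i)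
  rw [hsum] at h
  refine h.trans (le_of_eq ?_)
  have hmp := measurePreserving_swap_last k
  conv_lhs => rw [← hmp.map_eq]
  rw [setLIntegral_map Metric.isOpen_ball.measurableSet
    (measurable_dirichletWeight_mul_exp _ _ s).ennreal_ofReal hmp.measurable]
  simp only [← he, simplexGap_comp, dirichletWeight_comp]
  congr 2
  ext θ
  simp only [Set.mem_preimage, Metric.mem_ball, dist_pi_lt_iff hr]
  exact e.forall_congr_right (q := fun i => dist (θ i) (θs i) < r)

/-! ### The Laplace rate and the sandwich principle -/

/-- The polynomial rate `κ = (K - 1 - m) / 2 + ∑_{θsᵢ = 0} αᵢ` of the Laplace approximation. -/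
def laplaceRate {d : ℕ} (α θs : Fin (d + 1) → ℝ) : ℝ :=
  ((d : ℝ) - numZeros θs) / 2 + zeroParamSum α θs

theorem half_sub_sum_coordRate {d : ℕ} (α θs : Fin (d + 1) → ℝ) :
    1 / 2 - ∑ i, coordRate (α i) (θs i) = -laplaceRate α θs := by
  classical
  simp only [coordRate, laplaceRate, numZeros, zeroParamSum]
  rw [Finset.sum_ite, Finset.sum_const, nsmul_eq_mul]
  have h := Finset.card_filter_add_card_filter_not (s := (Finset.univ : Finset (Fin (d + 1))))
    (fun i => θs i = 0)
  rw [Finset.card_univ, Fintype.card_fin] at h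
  have h' : ((Finset.univ.filter fun i => θs i = 0).card : ℝ) +
      ((Finset.univ.filter fun i => ¬ θs i = 0).card : ℝ) = d + 1 := by exact_mod_cast h
  rw [← eq_sub_iff_add_eq'] at h'
  rw [h']
  have e1 : ∀ a b : ℝ, 1 / 2 - (a + (d + 1 - b) * (1 / 2)) = -((d - b) / 2 + a) := by
    intro a b; ring
  convert e1 _ _ using 4

/-- The subtracted `1/2` cancels one positive coordinate, and `K ≥ 2` leaves another coordinate,
whose contribution is positive. -/
theorem laplaceRate_pos {d : ℕ} (hd : 1 ≤ d) (α θs : Fin (d + 1) → ℝ) (hα : ∀ i, 0 < α i)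
    (hθs : θs ∈ stdSimplex ℝ (Fin (d + 1))) : 0 < laplaceRate α θs := by
  obtain ⟨k, hk⟩ := exists_pos_of_mem_stdSimplex hθs
  have h := half_sub_sum_coordRate α θs
  rw [← Finset.add_sum_erase _ _ (Finset.mem_univ k)] at h
  have hpos : 0 < ∑ i ∈ Finset.univ.erase k, coordRate (α i) (θs i) := by
    refine Finset.sum_pos (fun i _ => ?_) ?_
    · unfold coordRate; split_ifs
      · exact hα i
      · norm_num
    · rw [← Finset.card_pos, Finset.card_erase_of_mem (Finset.mem_univ k)]
      simpa using Nat.lt_of_succ_le hd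
  have : coordRate (α k) (θs k) = 1 / 2 := by simp [coordRate, hk.ne']
  linarith

/-- Two-sided Laplace estimate for integrands sandwiched between model integrands. -/
theorem exists_integral_laplace_bounds {d : ℕ} {α θs : Fin (d + 1) → ℝ} (hα : ∀ i, 0 < α i)
    (hθs : θs ∈ stdSimplex ℝ (Fin (d + 1))) {φ : ℝ → (Fin (d + 1) → ℝ) → ℝ} {c C r : ℝ}
    (hc : 0 < c) (hC : 0 < C) (hr : 0 < r)
    (hmeas : ∀ᶠ n in atTop, AEStronglyMeasurable (φ n) (simplexMeasure d))
    (hupper : ∀ᶠ n in atTop, ∀ᵐ θ ∂(simplexMeasure d), 0 ≤ φ n θ ∧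
      φ n θ ≤ dirichletWeight α θ * Real.exp (-(c * n * simplexGap θs θ)))
    (hlower : ∀ᶠ n in atTop, ∀ᵐ θ ∂(simplexMeasure d), θ ∈ Metric.ball θs r →
      dirichletWeight α θ * Real.exp (-(C * n * simplexGap θs θ)) ≤ φ n θ) :
    ∃ a b, 0 < a ∧ 0 < b ∧ ∀ᶠ n in atTop, Integrable (φ n) (simplexMeasure d) ∧
      a * n ^ (-laplaceRate α θs) ≤ ∫ θ, φ n θ ∂(simplexMeasure d) ∧
      ∫ θ, φ n θ ∂(simplexMeasure d) ≤ b * n ^ (-laplaceRate α θs) := by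
  obtain ⟨b, hb, hub⟩ := exists_lintegral_simplexGap_le α θs hα hθs.1
  obtain ⟨a, ha, hla⟩ := exists_le_setLIntegral_simplexGap α θs hα hθs hr
  simp only [half_sub_sum_coordRate] at hub hla
  refine ⟨a * C ^ (-laplaceRate α θs), b * c ^ (-laplaceRate α θs), by positivity, by positivity,
    ?_⟩
  filter_upwards [hmeas, hupper, hlower, eventually_gt_atTop 0,
    eventually_ge_atTop (1 / c), eventually_ge_atTop (1 / C)] with n h1 h2 h3 hn hnc hnC
  have hcn : 1 ≤ c * n := by rwa [div_le_iff₀' hc] at hnc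
  have hCn : 1 ≤ C * n := by rwa [div_le_iff₀' hC] at hnC
  have h0 : 0 ≤ᵐ[simplexMeasure d] φ n := h2.mono fun θ h => h.1
  have hU : ∫⁻ θ, ENNReal.ofReal (φ n θ) ∂(simplexMeasure d) ≤
      ENNReal.ofReal (b * c ^ (-laplaceRate α θs) * n ^ (-laplaceRate α θs)) := by
    rw [mul_assoc, ← Real.mul_rpow hc.le hn.le]
    exact (lintegral_mono_ae (h2.mono fun θ h => ENNReal.ofReal_le_ofReal h.2)).trans (hub _ hcn)
  have hint : Integrable (φ n) (simplexMeasure d) :=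
    ⟨h1, (hasFiniteIntegral_iff_ofReal h0).2 (hU.trans_lt ENNReal.ofReal_lt_top)⟩
  have hL : ENNReal.ofReal (a * C ^ (-laplaceRate α θs) * n ^ (-laplaceRate α θs)) ≤
      ∫⁻ θ, ENNReal.ofReal (φ n θ) ∂(simplexMeasure d) := by
    rw [mul_assoc, ← Real.mul_rpow hC.le hn.le]
    refine (hla _ hCn).trans (le_trans ?_ (setLIntegral_le_lintegral (Metric.ball θs r) _))
    refine setLIntegral_mono_ae' Metric.isOpen_ball.measurableSet ?_
    exact h3.mono fun θ h hθ => ENNReal.ofReal_le_ofReal (h hθ)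
  rw [← ofReal_integral_eq_lintegral_ofReal hint h0] at hU hL
  have hpos : 0 < n ^ (-laplaceRate α θs) := Real.rpow_pos_of_pos hn _
  exact ⟨hint, (ENNReal.ofReal_le_ofReal_iff (integral_nonneg_of_ae h0)).1 hL,
    (ENNReal.ofReal_le_ofReal_iff (by positivity)).1 hU⟩

/-! ### Relative entropy and the normalizing constant -/

/-- The relative entropy of `θs` with respect to `θ`. -/
def simplexEntropy {d : ℕ} (θs θ : Fin (d + 1) → ℝ) : ℝ :=
  ∑ i, θs i * (Real.log (θs i) - Real.log (θ i))

/-- A Hellinger-type bound: `log u ≤ u - 1` is applied to `u = √x / √p`, which yields `(p - x) + (√p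
- √x)²`, and `√p + √x ≤ 2` turns the last square into the gap. The terms `p - x` cancel on summation
over the simplex. -/
theorem coord_entropy_ge {p x : ℝ} (hp : 0 ≤ p) (hp1 : p ≤ 1) (hx : 0 < x) (hx1 : x ≤ 1) :
    (p - x) + coordGap p x / 4 ≤ p * (Real.log p - Real.log x) := by
  rcases hp.eq_or_lt with rfl | hp
  · simp [coordGap]; linarith
  · simp only [coordGap, hp.ne', if_false]
    obtain ⟨y, hy, rfl⟩ : ∃ y, 0 < y ∧ y ^ 2 = x := ⟨√x, by positivity, Real.sq_sqrt hx.le⟩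
    obtain ⟨q, hq, rfl⟩ : ∃ q, 0 < q ∧ q ^ 2 = p := ⟨√p, by positivity, Real.sq_sqrt hp.le⟩
    have h1 := Real.log_le_sub_one_of_pos (div_pos hy hq)
    rw [Real.log_div hy.ne' hq.ne'] at h1
    rw [Real.log_pow, Real.log_pow]
    push_cast
    have h2 : q ^ 2 * (Real.log y - Real.log q) ≤ q ^ 2 * (y / q - 1) := by gcongr
    have h3 : q ^ 2 * (y / q - 1) = q * y - q ^ 2 := by field_simp
    have h4 : (q + y) ^ 2 ≤ 4 := by nlinarith [sq_nonneg (q - y)]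
    have h5 : (y ^ 2 - q ^ 2) ^ 2 / 4 ≤ (q - y) ^ 2 := by
      have : (y ^ 2 - q ^ 2) ^ 2 = (q + y) ^ 2 * (q - y) ^ 2 := by ring
      rw [this]; nlinarith [sq_nonneg (q - y)]
    nlinarith

/-- Here `log u ≤ u - 1` with `u = p / x` gives `(p - x) + (x - p)² / x`, so `x` must stay away from
`0` where `p > 0`. This is the role of the truncation at `ε`. -/
theorem coord_entropy_le {p x ε C : ℝ} (hp : 0 ≤ p) (hε : 0 < ε) (hC : 1 ≤ C) (hCε : 1 / ε ≤ C)
    (hx : 0 < x) (hεx : 0 < p → ε ≤ x) :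
    p * (Real.log p - Real.log x) ≤ (p - x) + C * coordGap p x := by
  rcases hp.eq_or_lt with rfl | hp
  · simp [coordGap]; nlinarith
  · simp only [coordGap, hp.ne', if_false]
    have h1 := Real.log_le_sub_one_of_pos (div_pos hp hx)
    rw [Real.log_div hp.ne' hx.ne'] at h1
    have hxC : 1 / x ≤ C := (one_div_le_one_div_of_le hε (hεx hp)).trans hCε
    calc _ ≤ p * (p / x - 1) := by gcongr
      _ = (p - x) + 1 / x * (x - p) ^ 2 := by field_simp; ring
      _ ≤ _ := by gcongr

theorem stdSimplex_le_one {d : ℕ} {θ : Fin (d + 1) → ℝ} (hθ : θ ∈ stdSimplex ℝ (Fin (d + 1)))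
    (i : Fin (d + 1)) : θ i ≤ 1 :=
  hθ.2 ▸ Finset.single_le_sum (fun j _ => hθ.1 j) (Finset.mem_univ i)

theorem simplexEntropy_ge {d : ℕ} {θs θ : Fin (d + 1) → ℝ}
    (hθs : θs ∈ stdSimplex ℝ (Fin (d + 1))) (hθ : θ ∈ stdSimplex ℝ (Fin (d + 1)))
    (hpos : ∀ i, 0 < θ i) : simplexGap θs θ / 4 ≤ simplexEntropy θs θ := by
  have h := Finset.sum_le_sum fun i (_ : i ∈ Finset.univ) => coord_entropy_ge (hθs.1 i)
    (stdSimplex_le_one hθs i) (hpos i) (stdSimplex_le_one hθ i)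
  rw [Finset.sum_add_distrib, Finset.sum_sub_distrib, hθs.2, hθ.2, sub_self, zero_add,
    ← Finset.sum_div] at h
  exact h

theorem simplexEntropy_le {d : ℕ} {θs θ : Fin (d + 1) → ℝ} {ε : ℝ} (hε : 0 < ε)
    (hθs : θs ∈ stdSimplex ℝ (Fin (d + 1))) (hθ : θ ∈ truncatedSimplex θs ε)
    (hpos : ∀ i, 0 < θ i) : simplexEntropy θs θ ≤ max 1 (1 / ε) * simplexGap θs θ := by
  have h := Finset.sum_le_sum fun i (_ : i ∈ Finset.univ) => coord_entropy_le (hθs.1 i) hε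
    (le_max_left 1 (1 / ε)) (le_max_right _ _) (hpos i) (hθ.2 i)
  rw [Finset.sum_add_distrib, Finset.sum_sub_distrib, hθs.2, hθ.1.2, sub_self, zero_add,
    ← Finset.mul_sum] at h
  exact h

theorem exists_ball_subset_truncated {d : ℕ} {θs : Fin (d + 1) → ℝ} {ε : ℝ}
    (hεθ : ∀ i, 0 < θs i → ε < θs i) :
    ∃ r, 0 < r ∧ ∀ θ ∈ Metric.ball θs r, θ ∈ stdSimplex ℝ (Fin (d + 1)) →
      θ ∈ truncatedSimplex θs ε := by
  have : ∀ᶠ θ in nhds θs, ∀ i, 0 < θs i → ε < θ i := by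
    refine eventually_all.2 fun i => ?_
    by_cases hi : 0 < θs i
    · filter_upwards [(continuous_apply i).continuousAt.eventually (lt_mem_nhds (hεθ i hi))]
        with θ h _ using h
    · exact Eventually.of_forall fun θ h => absurd h hi
  obtain ⟨r, hr, h⟩ := Metric.eventually_nhds_iff_ball.1 this
  exact ⟨r, hr, fun θ hθ hs => ⟨hs, fun i hi => (h θ hθ i hi).le⟩⟩

/-- `∏ θᵢ ^ (αᵢ + t θsᵢ - 1)` in terms of the relative entropy. -/
theorem dirichletWeight_add_mul {d : ℕ} (α θs θ : Fin (d + 1) → ℝ) (t : ℝ) (hpos : ∀ i, 0 < θ i) :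
    dirichletWeight (fun i => α i + t * θs i) θ =
      Real.exp (t * ∑ i, θs i * Real.log (θs i)) *
        (dirichletWeight α θ * Real.exp (-(t * simplexEntropy θs θ))) := by
  have h : ∏ i, θ i ^ (t * θs i) = Real.exp (t * ∑ i, θs i * Real.log (θ i)) := by
    rw [Finset.mul_sum, Real.exp_sum]
    refine Finset.prod_congr rfl fun i _ => ?_
    rw [Real.rpow_def_of_pos (hpos i)]
    ring_nf
  have h2 : dirichletWeight (fun i => α i + t * θs i) θ =
      dirichletWeight α θ * ∏ i, θ i ^ (t * θs i) := by
    rw [dirichletWeight, dirichletWeight, ← Finset.prod_mul_distrib]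
    refine Finset.prod_congr rfl fun i _ => ?_
    rw [← Real.rpow_add (hpos i)]
    ring_nf
  rw [h2, h, mul_left_comm, ← Real.exp_add]
  congr 2
  simp only [simplexEntropy, mul_sub, Finset.sum_sub_distrib]
  ring

/-- The normalizing integral of the importance sampling distribution. -/
theorem exists_integral_entropy_bounds {d : ℕ} (hd : 1 ≤ d) {α θs : Fin (d + 1) → ℝ}
    (hα : ∀ i, 0 < α i) (hθs : θs ∈ stdSimplex ℝ (Fin (d + 1))) :
    ∃ a b, 0 < a ∧ 0 < b ∧ ∀ᶠ t in atTop,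
      a * t ^ (-laplaceRate α θs) ≤
        ∫ θ, dirichletWeight α θ * Real.exp (-(t * simplexEntropy θs θ)) ∂(simplexMeasure d) ∧
      ∫ θ, dirichletWeight α θ * Real.exp (-(t * simplexEntropy θs θ)) ∂(simplexMeasure d) ≤
        b * t ^ (-laplaceRate α θs) := by
  -- This `ε` is auxiliary: the normalizing integral is not truncated, and the upper bound on the
  -- entropy is needed only near `θs`.
  obtain ⟨ε, hε, hεθ⟩ : ∃ ε : ℝ, 0 < ε ∧ ∀ i, 0 < θs i → ε < θs i := by
    have : ∀ᶠ ε in nhdsWithin (0 : ℝ) (Set.Ioi 0), ∀ i, 0 < θs i → ε < θs i :=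
      eventually_all.2 fun i => by
        by_cases hi : 0 < θs i
        · filter_upwards [nhdsWithin_le_nhds (Iio_mem_nhds hi)] with ε h _ using h
        · exact Eventually.of_forall fun θ h => absurd h hi
    obtain ⟨ε, h1, h2⟩ := (this.and self_mem_nhdsWithin).exists
    exact ⟨ε, h2, h1⟩
  obtain ⟨r, hr, hball⟩ := exists_ball_subset_truncated hεθ
  have hM : Measurable (simplexEntropy θs) := by unfold simplexEntropy; fun_prop
  obtain ⟨a, b, ha, hb, h⟩ := exists_integral_laplace_bounds (c := 1 / 4) (C := max 1 (1 / ε))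
    (φ := fun t θ => dirichletWeight α θ * Real.exp (-(t * simplexEntropy θs θ)))
    hα hθs (by norm_num) (by positivity) hr
    (Eventually.of_forall fun t => ((measurable_dirichletWeight α).mul
      (hM.const_mul t).neg.exp).aestronglyMeasurable)
    (by
      filter_upwards [eventually_ge_atTop 0] with t ht
      filter_upwards [ae_mem_stdSimplex d, ae_simplexCoord_pos hd] with θ h1 h2
      have hw := dirichletWeight_nonneg (α := α) h1.1
      refine ⟨by positivity, mul_le_mul_of_nonneg_left (Real.exp_le_exp.2 ?_) hw⟩
      have := simplexEntropy_ge hθs h1 h2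
      nlinarith)
    (by
      filter_upwards [eventually_ge_atTop 0] with t ht
      filter_upwards [ae_mem_stdSimplex d, ae_simplexCoord_pos hd] with θ h1 h2 hθ
      have hw := dirichletWeight_nonneg (α := α) h1.1
      refine mul_le_mul_of_nonneg_left (Real.exp_le_exp.2 ?_) hw
      have := simplexEntropy_le hε hθs (hball θ hθ h1) h2
      nlinarith)
  exact ⟨a, b, ha, hb, h.mono fun t h => h.2⟩

/-! ### Taylor expansion, multipliers and the critical cone -/

/-- Second order Taylor expansion of a `C²` function. -/
theorem ContDiffAt.eventually_abs_taylor_two_le {E : Type*} [NormedAddCommGroup E]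
    [NormedSpace ℝ E] {f : E → ℝ} {x₀ : E} (hf : ContDiffAt ℝ 2 f x₀) {η : ℝ} (hη : 0 < η) :
    ∀ᶠ x in nhds x₀, |f x - f x₀ - fderiv ℝ f x₀ (x - x₀) -
      1 / 2 * fderiv ℝ (fderiv ℝ f) x₀ (x - x₀) (x - x₀)| ≤ η * ‖x - x₀‖ ^ 2 := by
  set A := fderiv ℝ f x₀
  set Q := fderiv ℝ (fderiv ℝ f) x₀
  have hsymm : ∀ v w, Q v w = Q w v := by
    have := hf.isSymmSndFDerivAt (by simp)
    exact fun v w => this v w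
  have hQ : HasFDerivAt (fderiv ℝ f) Q x₀ :=
    ((hf.fderiv_right (m := 1) (by norm_num)).differentiableAt (by norm_num)).hasFDerivAt
  have hdiff : ∀ᶠ x in nhds x₀, HasFDerivAt f (fderiv ℝ f x) x := by
    filter_upwards [hf.eventually (by simp)] with x hx
    exact (hx.differentiableAt (by norm_num)).hasFDerivAt
  have hlo := (hasFDerivAt_iff_isLittleO.1 hQ).def hη
  obtain ⟨δ, hδ, hb⟩ := Metric.eventually_nhds_iff_ball.1 (hdiff.and hlo)
  refine Metric.eventually_nhds_iff_ball.2 ⟨δ, hδ, fun x hx => ?_⟩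
  -- The mean value inequality is applied to the Taylor remainder. Symmetry of the second derivative
  -- identifies the derivative of `R` as the first-order remainder of `fderiv ℝ f`, which is small
  -- compared with the distance to `x₀`.
  set R : E → ℝ := fun z => f z - A (z - x₀) - 1 / 2 * Q (z - x₀) (z - x₀) with hR
  have hseg : segment ℝ x₀ x ⊆ Metric.ball x₀ δ :=
    (convex_ball x₀ δ).segment_subset (Metric.mem_ball_self hδ) hx
  have hder : ∀ z ∈ segment ℝ x₀ x,
      HasFDerivWithinAt R (fderiv ℝ f z - A - Q (z - x₀)) (segment ℝ x₀ x) z := by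
    intro z hz
    have hid : HasFDerivAt (fun z : E => z - x₀) (ContinuousLinearMap.id ℝ E) z :=
      (hasFDerivAt_id z).sub_const x₀
    have h1 := (hb z (hseg hz)).1
    have h2 : HasFDerivAt (fun z => A (z - x₀)) (A.comp (ContinuousLinearMap.id ℝ E)) z :=
      A.hasFDerivAt.comp z hid
    have h3 := ((Q.hasFDerivAt.comp z hid).clm_apply hid).const_mul (1 / 2 : ℝ)
    refine (((h1.sub h2).sub h3).congr_fderiv ?_).hasFDerivWithinAt
    ext v
    simp [hsymm v z, hsymm v x₀]
    ring
  have hmv := (convex_segment x₀ x).norm_image_sub_le_of_norm_hasFDerivWithin_le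
    (C := η * ‖x - x₀‖) hder (fun z hz => by
      refine ((hb z (hseg hz)).2).trans ?_
      gcongr
      obtain ⟨t, ht, rfl⟩ := (segment_eq_image' ℝ x₀ x ▸ hz)
      simp only [add_sub_cancel_left, norm_smul, Real.norm_eq_abs, abs_of_nonneg ht.1]
      exact mul_le_of_le_one_left (norm_nonneg _) ht.2)
    (left_mem_segment ℝ x₀ x) (right_mem_segment ℝ x₀ x)
  have e : R x - R x₀ = f x - f x₀ - A (x - x₀) - 1 / 2 * Q (x - x₀) (x - x₀) := by
    simp [hR]; ring
  rw [e, Real.norm_eq_abs] at hmv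
  calc _ ≤ _ := hmv
    _ = _ := by ring

/-- A quadratic form negative on a closed cone minus the origin is uniformly so. -/
theorem exists_neg_bound_on_cone {E : Type*} [NormedAddCommGroup E] [NormedSpace ℝ E]
    [FiniteDimensional ℝ E] (Q : E →L[ℝ] E →L[ℝ] ℝ) {S : Set E} (hS : IsClosed S)
    (hcone : ∀ w ∈ S, ∀ t : ℝ, t • w ∈ S) (hneg : ∀ w ∈ S, w ≠ 0 → Q w w < 0) :
    ∃ c, 0 < c ∧ ∀ w ∈ S, Q w w ≤ -(c * ‖w‖ ^ 2) := by
  have hK : IsCompact (S ∩ Metric.sphere 0 1) := (isCompact_sphere 0 1).inter_left hS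
  have hscale : ∀ c : ℝ, (∀ w ∈ S ∩ Metric.sphere 0 1, Q w w ≤ -c) →
      ∀ w ∈ S, Q w w ≤ -(c * ‖w‖ ^ 2) := by
    intro c h w hw
    by_cases hw0 : w = 0
    · simp [hw0]
    have hn : 0 < ‖w‖ := norm_pos_iff.2 hw0
    have := h (‖w‖⁻¹ • w) ⟨hcone w hw _, by simp [norm_smul, hn.ne']⟩
    simp only [map_smul, smul_apply, smul_eq_mul] at this
    have h2 := mul_le_mul_of_nonneg_left this (sq_nonneg ‖w‖)
    have e : ‖w‖ ^ 2 * (‖w‖⁻¹ * (‖w‖⁻¹ * Q w w)) = Q w w := by field_simp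
    linarith
  rcases (S ∩ Metric.sphere 0 1).eq_empty_or_nonempty with he | hne
  -- The cone may be trivial, for instance the critical cone at a vertex; then any constant works.
  · exact ⟨1, one_pos, hscale 1 (by simp [he])⟩
  · obtain ⟨w, hw, hmax⟩ := hK.exists_isMaxOn hne
      (f := fun w => Q w w) (Continuous.continuousOn (by fun_prop))
    have hw0 : w ≠ 0 := by
      rintro rfl
      simpa using hw.2
    refine ⟨-(Q w w), by linarith [hneg w hw.1 hw0], hscale _ fun v hv => ?_⟩
    simpa using hmax hv

theorem apply_eq_sum_single {d : ℕ} (A : (Fin (d + 1) → ℝ) →L[ℝ] ℝ) (v : Fin (d + 1) → ℝ) :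
    A v = ∑ i, v i * A (Pi.single i 1) := by
  conv_lhs => rw [pi_eq_sum_univ' v]
  simp [map_sum]

/-- A maximizer over the simplex admits Karush–Kuhn–Tucker multipliers. -/
theorem exists_isKKTMultiplier {d : ℕ} {h : (Fin (d + 1) → ℝ) → ℝ} {θs : Fin (d + 1) → ℝ}
    (hθs : θs ∈ stdSimplex ℝ (Fin (d + 1))) (hdiff : DifferentiableAt ℝ h θs)
    (hmax : IsLocalMaxOn h (stdSimplex ℝ (Fin (d + 1))) θs) :
    ∃ lam μ, IsKKTMultiplier h θs lam μ := by
  obtain ⟨k, hk⟩ := exists_pos_of_mem_stdSimplex hθs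
  have hle : ∀ i, 0 < θs i → ∀ j,
      fderiv ℝ h θs (Pi.single j 1) ≤ fderiv ℝ h θs (Pi.single i 1) := by
    intro i hi j
    by_cases hij : i = j
    · rw [hij]
    -- Moving the whole mass of coordinate `i` to `j` stays in the simplex, so the first-order
    -- condition along this direction compares the two partial derivatives.
    set y : Fin (d + 1) → ℝ := θs + θs i • (Pi.single j 1 - Pi.single i 1) with hy
    have hymem : y ∈ stdSimplex ℝ (Fin (d + 1)) := by
      refine ⟨fun l => ?_, ?_⟩
      · have := hθs.1 l
        by_cases hl : l = i
        · subst hl; simp [hy, hij]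
        · by_cases hl2 : l = j
          · subst hl2; simp [hy, hl]; linarith
          · simp [hy, hl, hl2, this]
      · simp [hy, Finset.sum_add_distrib, ← Finset.mul_sum, hθs.2]
    have h1 := hmax.hasFDerivWithinAt_nonpos hdiff.hasFDerivAt.hasFDerivWithinAt
      (sub_mem_posTangentConeAt_of_segment_subset
        ((convex_stdSimplex ℝ _).segment_subset hθs hymem))
    rw [hy, add_sub_cancel_left, map_smul, map_sub, smul_eq_mul] at h1
    nlinarith
  refine ⟨fun j => fderiv ℝ h θs (Pi.single k 1) - fderiv ℝ h θs (Pi.single j 1),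
    fderiv ℝ h θs (Pi.single k 1), fun j => by linarith [hle k hk j], fun j hj => ?_,
    fun j => by ring⟩
  linarith [hle k hk j, hle j hj k]

/-- The `μ` part vanishes on differences of simplex points, and complementary slackness removes `lam
i * θs i`. -/
theorem fderiv_sub_eq_of_isKKTMultiplier {d : ℕ} {h : (Fin (d + 1) → ℝ) → ℝ}
    {θs θ lam : Fin (d + 1) → ℝ} {μ : ℝ} (hK : IsKKTMultiplier h θs lam μ)
    (hθs : θs ∈ stdSimplex ℝ (Fin (d + 1))) (hθ : θ ∈ stdSimplex ℝ (Fin (d + 1))) :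
    fderiv ℝ h θs (θ - θs) = -∑ i, lam i * θ i := by
  rw [apply_eq_sum_single, ← Finset.sum_neg_distrib]
  have h0 : ∑ i, (θ i - θs i) * μ = 0 := by
    rw [← Finset.sum_mul, Finset.sum_sub_distrib, hθs.2, hθ.2]; simp
  rw [← sub_zero (∑ i, (θ - θs) i * _), ← h0, ← Finset.sum_sub_distrib]
  refine Finset.sum_congr rfl fun i _ => ?_
  rw [hK.2.2 i, Pi.sub_apply]
  rcases (hθs.1 i).eq_or_lt with h | h
  · rw [← h]; ring
  · rw [hK.2.1 i h]; ring

/-- The mass that `θ` puts on the zero coordinates of `θs`. -/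
def zeroMass {d : ℕ} (θs θ : Fin (d + 1) → ℝ) : ℝ := ∑ i, if θs i = 0 then θ i else 0

theorem zeroMass_nonneg {d : ℕ} {θs θ : Fin (d + 1) → ℝ} (hθ : ∀ i, 0 ≤ θ i) :
    0 ≤ zeroMass θs θ :=
  Finset.sum_nonneg fun i _ => by split_ifs; exacts [hθ i, le_rfl]

theorem zeroMass_le_norm {d : ℕ} (θs θ : Fin (d + 1) → ℝ) :
    zeroMass θs θ ≤ (d + 1) * ‖θ - θs‖ := by
  calc _ ≤ ∑ _i : Fin (d + 1), ‖θ - θs‖ := Finset.sum_le_sum fun i _ => by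
        split_ifs with h
        · have := norm_le_pi_norm (θ - θs) i
          rw [Pi.sub_apply, h, sub_zero] at this
          exact (le_abs_self _).trans this
        · exact norm_nonneg _
    _ = _ := by simp

theorem simplexGap_le_zeroMass_add {d : ℕ} (θs θ : Fin (d + 1) → ℝ) :
    simplexGap θs θ ≤ zeroMass θs θ + (d + 1) * ‖θ - θs‖ ^ 2 := by
  have : zeroMass θs θ + (d + 1) * ‖θ - θs‖ ^ 2 =
      ∑ i, ((if θs i = 0 then θ i else 0) + ‖θ - θs‖ ^ 2) := by
    rw [Finset.sum_add_distrib]; simp [zeroMass]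
  rw [this]
  refine Finset.sum_le_sum fun i _ => ?_
  unfold coordGap
  split_ifs
  · have := sq_nonneg ‖θ - θs‖; linarith
  · have := norm_le_pi_norm (θ - θs) i
    rw [zero_add, ← sq_abs]
    gcongr
    exact this

/-- On a zero coordinate `θᵢ² ≤ θᵢ`, so the linear gap also dominates the square. -/
theorem norm_sq_le_simplexGap {d : ℕ} {θs θ : Fin (d + 1) → ℝ}
    (hθ : θ ∈ stdSimplex ℝ (Fin (d + 1))) : ‖θ - θs‖ ^ 2 ≤ simplexGap θs θ := by
  have hg : 0 ≤ simplexGap θs θ := simplexGap_nonneg hθ.1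
  have : ‖θ - θs‖ ≤ √(simplexGap θs θ) := by
    refine (pi_norm_le_iff_of_nonneg (Real.sqrt_nonneg _)).2 fun i => ?_
    refine Real.le_sqrt_of_sq_le ?_
    have h1 : coordGap (θs i) (θ i) ≤ simplexGap θs θ :=
      Finset.single_le_sum (f := fun i => coordGap (θs i) (θ i))
        (fun j _ => coordGap_nonneg (hθ.1 j)) (Finset.mem_univ i)
    refine le_trans ?_ h1
    rw [Pi.sub_apply, Real.norm_eq_abs, sq_abs]
    unfold coordGap
    split_ifs with h
    · rw [h, sub_zero]
      nlinarith [hθ.1 i, stdSimplex_le_one hθ i]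
    · exact le_rfl
  calc _ ≤ √(simplexGap θs θ) ^ 2 := by gcongr
    _ = _ := Real.sq_sqrt hg

theorem simplexGap_le_card {d : ℕ} {θs θ : Fin (d + 1) → ℝ}
    (hθs : θs ∈ stdSimplex ℝ (Fin (d + 1))) (hθ : θ ∈ stdSimplex ℝ (Fin (d + 1))) :
    simplexGap θs θ ≤ d + 1 := by
  calc _ ≤ ∑ _i : Fin (d + 1), (1 : ℝ) := Finset.sum_le_sum fun i _ => by
        have h1 := hθs.1 i
        have h2 := hθ.1 i
        have h3 := stdSimplex_le_one hθs i
        have h4 := stdSimplex_le_one hθ i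
        unfold coordGap
        split_ifs
        · exact h4
        · nlinarith
    _ = _ := by simp

theorem isClosed_criticalCone {d : ℕ} (θs : Fin (d + 1) → ℝ) : IsClosed (criticalCone θs) := by
  have : criticalCone θs = {v | ∑ i, v i = 0} ∩ ⋂ i, {v | θs i = 0 → v i = 0} := by
    ext v; simp [criticalCone]
  rw [this]
  refine (isClosed_eq (by fun_prop) continuous_const).inter (isClosed_iInter fun i => ?_)
  by_cases h : θs i = 0
  · simpa [h] using isClosed_eq (continuous_apply i) continuous_const
  · simp [h]

/-- Decomposition of a feasible direction into a critical direction and a remainder controlled by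
the mass on the active constraints. -/
theorem exists_mem_criticalCone {d : ℕ} {θs θ : Fin (d + 1) → ℝ}
    (hθs : θs ∈ stdSimplex ℝ (Fin (d + 1))) (hθ : θ ∈ stdSimplex ℝ (Fin (d + 1))) :
    ∃ w ∈ criticalCone θs, ‖θ - θs - w‖ ≤ zeroMass θs θ := by
  obtain ⟨k, hk⟩ := exists_pos_of_mem_stdSimplex hθs
  have hs := zeroMass_nonneg (θs := θs) hθ.1
  set z : Fin (d + 1) → ℝ := fun i => if θs i = 0 then θ i else 0 with hz
  refine ⟨θ - θs - (z - Pi.single k (zeroMass θs θ)), ⟨?_, fun i hi => ?_⟩, ?_⟩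
  · simp only [Pi.sub_apply, Finset.sum_sub_distrib, hθ.2, hθs.2, Finset.sum_pi_single']
    simp [hz, zeroMass]
  · have : i ≠ k := by rintro rfl; exact hk.ne' hi
    simp [hz, hi, this]
  · rw [sub_sub_cancel]
    refine (pi_norm_le_iff_of_nonneg hs).2 fun i => ?_
    by_cases hi : i = k
    · subst hi
      simp [hz, hk.ne', abs_of_nonneg hs]
    · simp only [Pi.sub_apply, Pi.single_eq_of_ne hi, sub_zero, Real.norm_eq_abs]
      have h0 : ∀ j, 0 ≤ z j := fun j => by
        simp only [hz]; split_ifs; exacts [hθ.1 j, le_rfl]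
      rw [abs_of_nonneg (h0 i)]
      exact Finset.single_le_sum (fun j _ => h0 j) (Finset.mem_univ i)

/-! ### Comparison of `H` with the model gap -/

namespace LaplaceAssumptions

variable {d : ℕ} {H : (Fin (d + 1) → ℝ) → EReal} {θs : Fin (d + 1) → ℝ}

theorem coe_toReal_maximizer (hH : LaplaceAssumptions H θs) :
    ((H θs).toReal : EReal) = H θs := by
  obtain ⟨U, -, hU, hb, -⟩ := hH.contDiff
  exact EReal.coe_toReal (hH.ne_top _) (hb _ hU)

theorem contDiffAt (hH : LaplaceAssumptions H θs) :
    ContDiffAt ℝ 2 (fun θ => (H θ).toReal) θs := by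
  obtain ⟨U, hUo, hU, -, hc⟩ := hH.contDiff
  exact hc.contDiffAt (hUo.mem_nhds hU)

theorem eventually_ne_bot (hH : LaplaceAssumptions H θs) : ∀ᶠ θ in nhds θs, H θ ≠ ⊥ := by
  obtain ⟨U, hUo, hU, hb, -⟩ := hH.contDiff
  exact (hUo.eventually_mem hU).mono hb

theorem isLocalMaxOn (hH : LaplaceAssumptions H θs) :
    IsLocalMaxOn (fun θ => (H θ).toReal) (stdSimplex ℝ (Fin (d + 1))) θs := by
  filter_upwards [self_mem_nhdsWithin, nhdsWithin_le_nhds hH.eventually_ne_bot] with θ h1 h2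
  by_cases h : θ = θs
  · rw [h]
  · refine EReal.toReal_le_toReal (hH.unique_max θ h1 h).le h2 (hH.ne_top _)

/-- First and second order description of `H` near its maximizer. -/
theorem exists_multiplier_taylor (hH : LaplaceAssumptions H θs) :
    ∃ lam : Fin (d + 1) → ℝ, (∀ i, 0 ≤ lam i) ∧ (∀ i, 0 < θs i → lam i = 0) ∧
      (∀ i, θs i = 0 → 0 < lam i) ∧ ∀ η, 0 < η → ∀ᶠ θ in nhds θs,
        θ ∈ stdSimplex ℝ (Fin (d + 1)) →
        |(H θs).toReal - (H θ).toReal - (∑ i, lam i * θ i -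
          1 / 2 * fderiv ℝ (fderiv ℝ fun θ => (H θ).toReal) θs (θ - θs) (θ - θs))| ≤
          η * ‖θ - θs‖ ^ 2 := by
  obtain ⟨lam, μ, hK⟩ := exists_isKKTMultiplier hH.mem_simplex
    (hH.contDiffAt.differentiableAt (by norm_num)) hH.isLocalMaxOn
  refine ⟨lam, hK.1, hK.2.1, hH.strict_compl lam μ hK, fun η hη => ?_⟩
  filter_upwards [hH.contDiffAt.eventually_abs_taylor_two_le hη] with θ h hθ
  rw [fderiv_sub_eq_of_isKKTMultiplier hK hH.mem_simplex hθ] at h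
  rw [← abs_neg]
  refine le_trans (le_of_eq ?_) h
  congr 1
  ring

theorem exists_local_upper (hH : LaplaceAssumptions H θs) :
    ∃ C, 0 < C ∧ ∀ᶠ θ in nhds θs, θ ∈ stdSimplex ℝ (Fin (d + 1)) →
      (H θs).toReal - (H θ).toReal ≤ C * simplexGap θs θ := by
  obtain ⟨lam, hl0, hl1, -, hT⟩ := hH.exists_multiplier_taylor
  set Q := fderiv ℝ (fderiv ℝ fun θ => (H θ).toReal) θs
  have hL : 0 ≤ ∑ i, lam i := Finset.sum_nonneg fun i _ => hl0 i
  refine ⟨∑ i, lam i + (‖Q‖ + 1), by positivity, ?_⟩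
  filter_upwards [hT 1 one_pos] with θ h hθ
  have h1 := (abs_le.1 (h hθ)).2
  have h2 : |Q (θ - θs) (θ - θs)| ≤ ‖Q‖ * ‖θ - θs‖ * ‖θ - θs‖ := Q.le_opNorm₂ _ _
  have h3 := (abs_le.1 h2).1
  have hg0 := simplexGap_nonneg (θs := θs) hθ.1
  have h4 : ∑ i, lam i * θ i ≤ (∑ i, lam i) * simplexGap θs θ := by
    rw [Finset.sum_mul]
    refine Finset.sum_le_sum fun i _ => ?_
    rcases (hH.mem_simplex.1 i).eq_or_lt with h | h
    · refine mul_le_mul_of_nonneg_left ?_ (hl0 i)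
      have := Finset.single_le_sum (f := fun i => coordGap (θs i) (θ i))
        (fun j _ => coordGap_nonneg (hθ.1 j)) (Finset.mem_univ i)
      simpa [coordGap, simplexGap, ← h] using this
    · simp [hl1 i h]
  have h5 := norm_sq_le_simplexGap (θs := θs) hθ
  have h6 : ‖Q‖ * ‖θ - θs‖ ^ 2 ≤ ‖Q‖ * simplexGap θs θ := by gcongr
  have h7 : 0 ≤ ‖Q‖ * ‖θ - θs‖ ^ 2 := by positivity
  nlinarith

/-- Split `θ - θs = w + u` with `w` critical and `‖u‖` at most the zero mass `s`. Strict
complementarity gives a gain `l * s`, the Hessian a gain of order `‖w‖²`; every Hessian term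
involving `u` is `s` times something small near `θs`, hence absorbed by `l * s`. -/
theorem exists_local_lower (hH : LaplaceAssumptions H θs) :
    ∃ c, 0 < c ∧ ∀ᶠ θ in nhds θs, θ ∈ stdSimplex ℝ (Fin (d + 1)) →
      c * simplexGap θs θ ≤ (H θs).toReal - (H θ).toReal := by
  obtain ⟨lam, hl0, -, hl2, hT⟩ := hH.exists_multiplier_taylor
  set Q := fderiv ℝ (fderiv ℝ fun θ => (H θ).toReal) θs
  obtain ⟨c, hc, hQ⟩ := exists_neg_bound_on_cone Q (isClosed_criticalCone θs)
    (fun w hw t => ⟨by simp [← Finset.mul_sum, hw.1], fun i hi => by simp [hw.2 i hi]⟩) hH.neg_def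
  obtain ⟨l, hl, hlz⟩ : ∃ l, 0 < l ∧ ∀ i, θs i = 0 → l ≤ lam i := by
    -- The default value `1` off the zero set gives a positive minimum even when `θs` has no zero
    -- coordinate.
    have hne : (Finset.univ.image fun i => if θs i = 0 then lam i else 1).Nonempty :=
      ⟨_, Finset.mem_image_of_mem _ (Finset.mem_univ 0)⟩
    refine ⟨Finset.min' _ hne, ?_, fun i hi => Finset.min'_le _ _ ?_⟩
    · rw [Finset.lt_min'_iff]
      intro y hy
      obtain ⟨i, -, rfl⟩ := Finset.mem_image.1 hy
      split_ifs with h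
      exacts [hl2 i h, one_pos]
    · exact Finset.mem_image.2 ⟨i, Finset.mem_univ i, by simp [hi]⟩
  set b := min (c / 4) (l / 4) with hb
  have hb0 : 0 < b := by positivity
  have hbc : b ≤ c / 4 := min_le_left _ _
  have hbl : b ≤ l / 4 := min_le_right _ _
  -- The radius makes `s ≤ 1`, hence `s² ≤ s`, and bounds the Hessian terms involving `u` by `l / 2
  -- * s`.
  obtain ⟨ρ, hρ, hρ1, hρQ⟩ : ∃ ρ : ℝ, 0 < ρ ∧ ρ * (d + 1) ≤ 1 ∧
      ρ * (‖Q‖ * (2 + 3 * (d + 1))) ≤ l / 2 := by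
    set q := ‖Q‖ * (2 + 3 * ((d : ℝ) + 1)) with hq
    have hq0 : 0 ≤ q := by positivity
    refine ⟨min (1 / (d + 1)) (l / 2 / (q + 1)), by positivity, ?_, ?_⟩
    · rw [← le_div_iff₀ (by positivity)]; exact min_le_left _ _
    · calc _ ≤ l / 2 / (q + 1) * q := by gcongr; exact min_le_right _ _
        _ ≤ l / 2 / (q + 1) * (q + 1) := by gcongr; linarith
        _ = _ := by field_simp
  refine ⟨b / 2 / (d + 1), by positivity, ?_⟩
  filter_upwards [hT (b / 2) (by positivity), Metric.ball_mem_nhds θs hρ] with θ h hθρ hθ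
  have h1 := (abs_le.1 (h hθ)).1
  rw [Metric.mem_ball, dist_eq_norm] at hθρ
  have hs0 := zeroMass_nonneg (θs := θs) hθ.1
  have hsn := zeroMass_le_norm θs θ
  obtain ⟨w, hw, hwu⟩ := exists_mem_criticalCone hH.mem_simplex hθ
  set s := zeroMass θs θ with hs
  set v := θ - θs with hv
  obtain ⟨u, hu⟩ : ∃ u, u = v - w := ⟨_, rfl⟩
  rw [← hu] at hwu
  have hvw : v = w + u := by rw [hu]; abel
  have hΛ : l * s ≤ ∑ i, lam i * θ i := by
    rw [hs, zeroMass, Finset.mul_sum]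
    refine Finset.sum_le_sum fun i _ => ?_
    split_ifs with hi
    · exact mul_le_mul_of_nonneg_right (hlz i hi) (hθ.1 i)
    · rw [mul_zero]; exact mul_nonneg (hl0 i) (hθ.1 i)
  have hwn : ‖w‖ ≤ ‖v‖ + s := by
    have : w = v - u := by rw [hvw]; abel
    rw [this]; exact (norm_sub_le _ _).trans (by gcongr)
  have hQv : Q v v ≤ -(c * ‖w‖ ^ 2) + l / 2 * s := by
    have e : Q v v = Q w w + Q w u + Q u w + Q u u := by
      rw [hvw]; simp only [map_add, add_apply]; ring
    have e1 := (abs_le.1 (Q.le_opNorm₂ w u)).2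
    have e2 := (abs_le.1 (Q.le_opNorm₂ u w)).2
    have e3 := (abs_le.1 (Q.le_opNorm₂ u u)).2
    have e4 : ‖Q‖ * ‖w‖ * ‖u‖ + ‖Q‖ * ‖u‖ * ‖w‖ + ‖Q‖ * ‖u‖ * ‖u‖ ≤ l / 2 * s := by
      calc _ = ‖Q‖ * (2 * ‖w‖ + ‖u‖) * ‖u‖ := by ring
        _ ≤ ‖Q‖ * (2 * (ρ + (d + 1) * ρ) + (d + 1) * ρ) * s := by
            have : s ≤ (d + 1) * ρ := hsn.trans (by gcongr)
            gcongr
            · exact hwn.trans (by gcongr)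
            · exact hwu.trans this
        _ = ρ * (‖Q‖ * (2 + 3 * (d + 1))) * s := by ring
        _ ≤ _ := by gcongr
    linarith [hQ w hw]
  have hs1 : s ≤ 1 := hsn.trans (by nlinarith)
  have hvn : ‖v‖ ^ 2 ≤ 2 * ‖w‖ ^ 2 + 2 * s := by
    have : ‖v‖ ≤ ‖w‖ + s := by rw [hvw]; exact (norm_add_le _ _).trans (by gcongr)
    calc _ ≤ (‖w‖ + s) ^ 2 := by gcongr
      _ ≤ _ := by nlinarith [sq_nonneg (‖w‖ - s)]
  have hgap := simplexGap_le_zeroMass_add θs θ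
  rw [← hv, ← hs] at hgap
  have hw2 := sq_nonneg ‖w‖
  have hmain : b * ‖v‖ ^ 2 + b * s ≤ ∑ i, lam i * θ i - 1 / 2 * Q v v := by
    have k1 : b * ‖v‖ ^ 2 ≤ b * (2 * ‖w‖ ^ 2 + 2 * s) := by gcongr
    have k2 : b * ‖w‖ ^ 2 ≤ c / 4 * ‖w‖ ^ 2 := by gcongr
    have k3 : b * s ≤ l / 4 * s := by gcongr
    nlinarith
  have hfin : b / 2 / (d + 1) * simplexGap θs θ ≤ b / 2 * s + b / 2 * ‖v‖ ^ 2 := by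
    calc _ ≤ b / 2 / (d + 1) * (s + (d + 1) * ‖v‖ ^ 2) := by gcongr
      _ = b / 2 / (d + 1) * s + b / 2 * ‖v‖ ^ 2 := by field_simp
      _ ≤ b / 2 * s + b / 2 * ‖v‖ ^ 2 := by
          have : b / 2 / ((d : ℝ) + 1) ≤ b / 2 :=
            div_le_self (by positivity) (by linarith [d.cast_nonneg (α := ℝ)])
          gcongr
  nlinarith

/-- Global decay of `H` away from its maximizer. -/
theorem exists_global_lower (hH : LaplaceAssumptions H θs) :
    ∃ c, 0 < c ∧ ∀ θ ∈ stdSimplex ℝ (Fin (d + 1)),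
      H θ ≤ (((H θs).toReal - c * simplexGap θs θ : ℝ) : EReal) := by
  obtain ⟨c₁, hc₁, hloc⟩ := hH.exists_local_lower
  obtain ⟨r, hr, hb⟩ := Metric.eventually_nhds_iff_ball.1 (hloc.and hH.eventually_ne_bot)
  obtain ⟨c₂, hc₂, hfar⟩ : ∃ c, 0 < c ∧
      ∀ θ ∈ stdSimplex ℝ (Fin (d + 1)) \ Metric.ball θs r,
        H θ ≤ (((H θs).toReal - c * (d + 1) : ℝ) : EReal) := by
    have hK : IsCompact (stdSimplex ℝ (Fin (d + 1)) \ Metric.ball θs r) :=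
      (isCompact_stdSimplex ℝ _).diff Metric.isOpen_ball
    rcases (stdSimplex ℝ (Fin (d + 1)) \ Metric.ball θs r).eq_empty_or_nonempty with he | hne
    · exact ⟨1, one_pos, by simp [he]⟩
    · obtain ⟨θ₁, h1, hmax⟩ := hK.exists_isMaxOn hne (hH.continuousOn.mono Set.sdiff_subset)
      have hlt : H θ₁ < H θs := by
        refine hH.unique_max θ₁ h1.1 ?_
        rintro rfl
        exact h1.2 (Metric.mem_ball_self hr)
      -- The maximum off the ball may be `-∞`, so a real level strictly between it and `H θs` takes
      -- its place. Dividing by `d + 1`, an upper bound for the gap, makes the constant drop linear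
      -- in the gap.
      obtain ⟨x, hx1, hx2⟩ := EReal.lt_iff_exists_real_btwn.1 hlt
      rw [← hH.coe_toReal_maximizer, EReal.coe_lt_coe_iff] at hx2
      refine ⟨((H θs).toReal - x) / (d + 1), div_pos (by linarith) (by positivity),
        fun θ hθ => ((hmax hθ : H θ ≤ H θ₁).trans hx1.le).trans (le_of_eq ?_)⟩
      congr 1
      field_simp
      ring
  refine ⟨min c₁ c₂, lt_min hc₁ hc₂, fun θ hθ => ?_⟩
  have hg := simplexGap_nonneg (θs := θs) hθ.1
  by_cases hθr : θ ∈ Metric.ball θs r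
  · obtain ⟨h1, h2⟩ := hb θ hθr
    rw [← EReal.coe_toReal (hH.ne_top θ) h2, EReal.coe_le_coe_iff]
    have := h1 hθ
    have : min c₁ c₂ * simplexGap θs θ ≤ c₁ * simplexGap θs θ := by
      gcongr; exact min_le_left _ _
    linarith
  · refine (hfar θ ⟨hθ, hθr⟩).trans (EReal.coe_le_coe_iff.2 ?_)
    have h1 : min c₁ c₂ * simplexGap θs θ ≤ c₂ * (d + 1) :=
      mul_le_mul (min_le_right _ _) (simplexGap_le_card hH.mem_simplex hθ) hg hc₂.le
    linarith

theorem exists_expScaled_le (hH : LaplaceAssumptions H θs) :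
    ∃ c, 0 < c ∧ ∀ n : ℝ, 0 ≤ n → ∀ θ ∈ stdSimplex ℝ (Fin (d + 1)),
      expScaled H n θ ≤ Real.exp (n * (H θs).toReal) * Real.exp (-(c * n * simplexGap θs θ)) := by
  obtain ⟨c, hc, h⟩ := hH.exists_global_lower
  refine ⟨c, hc, fun n hn θ hθ => ?_⟩
  have h1 : (n : EReal) * H θ ≤ ((n * ((H θs).toReal - c * simplexGap θs θ) : ℝ) : EReal) := by
    rw [EReal.coe_mul]
    exact mul_le_mul_of_nonneg_left (h θ hθ) (by exact_mod_cast hn)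
  have h2 := EReal.exp_monotone h1
  rw [EReal.exp_coe] at h2
  have h3 := ENNReal.toReal_mono ENNReal.ofReal_ne_top h2
  rw [ENNReal.toReal_ofReal (Real.exp_pos _).le] at h3
  refine h3.trans (le_of_eq ?_)
  rw [← Real.exp_add]
  congr 1; ring

theorem exists_le_expScaled (hH : LaplaceAssumptions H θs) :
    ∃ C r, 0 < C ∧ 0 < r ∧ ∀ n : ℝ, 0 ≤ n → ∀ θ ∈ Metric.ball θs r,
      θ ∈ stdSimplex ℝ (Fin (d + 1)) →
      Real.exp (n * (H θs).toReal) * Real.exp (-(C * n * simplexGap θs θ)) ≤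
        expScaled H n θ := by
  obtain ⟨C, hC, hloc⟩ := hH.exists_local_upper
  obtain ⟨r, hr, hb⟩ := Metric.eventually_nhds_iff_ball.1 (hloc.and hH.eventually_ne_bot)
  refine ⟨C, r, hC, hr, fun n hn θ hθr hθ => ?_⟩
  obtain ⟨h1, h2⟩ := hb θ hθr
  have h1 := h1 hθ
  rw [expScaled, ← EReal.coe_toReal (hH.ne_top θ) h2, ← EReal.coe_mul, EReal.exp_coe,
    ENNReal.toReal_ofReal (Real.exp_pos _).le, ← Real.exp_add]
  refine Real.exp_le_exp.2 ?_
  nlinarith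

theorem aemeasurable_expScaled (hH : LaplaceAssumptions H θs) (n : ℝ) :
    AEMeasurable (expScaled H n) (simplexMeasure d) := by
  have h : AEMeasurable H (simplexMeasure d) := by
    have := hH.continuousOn.aemeasurable (μ := simplexMeasure d)
      (isClosed_stdSimplex ℝ _).measurableSet
    rwa [Measure.restrict_eq_self_of_ae_mem (ae_mem_stdSimplex d)] at this
  exact (EReal.exp_monotone.measurable.comp_aemeasurable (h.const_mul _)).ennreal_toReal

end LaplaceAssumptions

/-! ### Dirichlet measures as densities on the simplex -/

theorem multiBeta_pos {d : ℕ} {α : Fin (d + 1) → ℝ} (hα : ∀ i, 0 < α i) : 0 < multiBeta α :=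
  div_pos (Finset.prod_pos fun i _ => Real.Gamma_pos_of_pos (hα i))
    (Real.Gamma_pos_of_pos (Finset.sum_pos (fun i _ => hα i) ⟨0, Finset.mem_univ _⟩))

theorem dirichletDensity_eq {d : ℕ} (α θ : Fin (d + 1) → ℝ) :
    dirichletDensity α θ = 1 / multiBeta α * dirichletWeight α θ := rfl

theorem measurable_dirichletDensity {d : ℕ} (α : Fin (d + 1) → ℝ) :
    Measurable (dirichletDensity α) :=
  (measurable_dirichletWeight α).const_mul _

theorem dirichletDensity_nonneg {d : ℕ} {α θ : Fin (d + 1) → ℝ} (hα : ∀ i, 0 < α i)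
    (hθ : ∀ i, 0 ≤ θ i) : 0 ≤ dirichletDensity α θ :=
  mul_nonneg (one_div_nonneg.2 (multiBeta_pos hα).le) (dirichletWeight_nonneg hθ)

theorem dirichletMeasure_eq_withDensity {d : ℕ} (α : Fin (d + 1) → ℝ) :
    dirichletMeasure α =
      (simplexMeasure d).withDensity fun θ => ENNReal.ofReal (dirichletDensity α θ) := by
  ext s hs
  rw [dirichletMeasure, Measure.map_apply continuous_simplexCoord.measurable hs,
    withDensity_apply _ (continuous_simplexCoord.measurable hs), withDensity_apply _ hs,
    simplexMeasure, setLIntegral_map hs (measurable_dirichletDensity α).ennreal_ofReal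
      continuous_simplexCoord.measurable]

theorem integral_dirichletMeasure {d : ℕ} {α : Fin (d + 1) → ℝ} (hα : ∀ i, 0 < α i)
    (f : (Fin (d + 1) → ℝ) → ℝ) :
    ∫ θ, f θ ∂(dirichletMeasure α) =
      ∫ θ, dirichletDensity α θ * f θ ∂(simplexMeasure d) := by
  rw [dirichletMeasure_eq_withDensity, integral_withDensity_eq_integral_toReal_smul
    (measurable_dirichletDensity α).ennreal_ofReal (by simp)]
  refine integral_congr_ae ((ae_mem_stdSimplex d).mono fun θ hθ => ?_)
  simp only [smul_eq_mul]
  rw [ENNReal.toReal_ofReal (dirichletDensity_nonneg hα hθ.1)]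

theorem integrable_dirichletMeasure_iff {d : ℕ} {α : Fin (d + 1) → ℝ} (hα : ∀ i, 0 < α i)
    (f : (Fin (d + 1) → ℝ) → ℝ) :
    Integrable f (dirichletMeasure α) ↔
      Integrable (fun θ => dirichletDensity α θ * f θ) (simplexMeasure d) := by
  rw [dirichletMeasure_eq_withDensity, integrable_withDensity_iff_integrable_smul'
    (measurable_dirichletDensity α).ennreal_ofReal (by simp)]
  refine integrable_congr ((ae_mem_stdSimplex d).mono fun θ hθ => ?_)
  simp only [smul_eq_mul]
  rw [ENNReal.toReal_ofReal (dirichletDensity_nonneg hα hθ.1)]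

/-- If the Dirichlet distribution has total mass one, then the multivariate Beta function is the
integral of the unnormalized density. -/
theorem integral_dirichletWeight {d : ℕ} {α : Fin (d + 1) → ℝ} (hα : ∀ i, 0 < α i)
    [IsProbabilityMeasure (dirichletMeasure α)] :
    ∫ θ, dirichletWeight α θ ∂(simplexMeasure d) = multiBeta α := by
  have h := integral_dirichletMeasure hα fun _ => 1
  simp only [integral_const, probReal_univ, smul_eq_mul, mul_one, dirichletDensity_eq,
    integral_const_mul] at h
  have := multiBeta_pos hα
  field_simp at h
  exact h.symm

/-- Isolates the exponential prefactor of the normalizing constant, which cancels against that of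
the reciprocal sampling density in the second moment. -/
theorem multiBeta_isParam {d : ℕ} (hd : 1 ≤ d) {α θs : Fin (d + 1) → ℝ} {γ n : ℝ}
    (hβ : ∀ i, 0 < isParam α θs γ n i)
    [IsProbabilityMeasure (dirichletMeasure (isParam α θs γ n))] :
    multiBeta (isParam α θs γ n) = Real.exp (n ^ γ * ∑ i, θs i * Real.log (θs i)) *
      ∫ θ, dirichletWeight α θ * Real.exp (-(n ^ γ * simplexEntropy θs θ))
        ∂(simplexMeasure d) := by
  rw [← integral_dirichletWeight hβ, ← integral_const_mul]
  exact integral_congr_ae ((ae_simplexCoord_pos hd).mono fun θ hθ =>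
    dirichletWeight_add_mul α θs θ (n ^ γ) hθ)

theorem isParam_pos {d : ℕ} {α θs : Fin (d + 1) → ℝ} (hα : ∀ i, 0 < α i)
    (hθs : ∀ i, 0 ≤ θs i) {γ n : ℝ} (hn : 0 ≤ n) (i : Fin (d + 1)) :
    0 < isParam α θs γ n i := by
  have := Real.rpow_nonneg hn γ
  have := mul_nonneg this (hθs i)
  have := hα i
  unfold isParam
  linarith

theorem expScaled_nonneg {d : ℕ} (H : (Fin (d + 1) → ℝ) → EReal) (n : ℝ)
    (θ : Fin (d + 1) → ℝ) : 0 ≤ expScaled H n θ := ENNReal.toReal_nonneg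

theorem measurableSet_truncatedSimplex {d : ℕ} (θs : Fin (d + 1) → ℝ) (ε : ℝ) :
    MeasurableSet (truncatedSimplex θs ε) := by
  have : truncatedSimplex θs ε =
      stdSimplex ℝ (Fin (d + 1)) ∩ ⋂ i, {θ | 0 < θs i → ε ≤ θ i} := by
    ext θ; simp [truncatedSimplex]
  rw [this]
  refine (isClosed_stdSimplex ℝ _).measurableSet.inter (MeasurableSet.iInter fun i => ?_)
  by_cases h : 0 < θs i
  · simpa [h] using measurableSet_le measurable_const (measurable_pi_apply i)
  · simp [h]

/-! ### Asymptotics of the estimand and of the second moment -/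

section Rates

variable {d : ℕ} {H : (Fin (d + 1) → ℝ) → EReal} {α θs : Fin (d + 1) → ℝ}

/-- Laplace asymptotics of the estimand. -/
theorem exists_estimand_bounds (hH : LaplaceAssumptions H θs) (hα : ∀ i, 0 < α i) :
    ∃ a b, 0 < a ∧ 0 < b ∧ ∀ᶠ n in atTop,
      Integrable (fun θ => dirichletDensity α θ * expScaled H n θ) (simplexMeasure d) ∧
      a * (Real.exp (n * (H θs).toReal) * n ^ (-laplaceRate α θs)) ≤ estimand H α n ∧
      estimand H α n ≤ b * (Real.exp (n * (H θs).toReal) * n ^ (-laplaceRate α θs)) := by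
  obtain ⟨c, hc, hup⟩ := hH.exists_expScaled_le
  obtain ⟨C, r, hC, hr, hlow⟩ := hH.exists_le_expScaled
  set h := (H θs).toReal
  have hexp : ∀ n : ℝ, Real.exp (n * h) * Real.exp (-(n * h)) = 1 := fun n => by
    rw [← Real.exp_add]; simp
  obtain ⟨a, b, ha, hb, hev⟩ := exists_integral_laplace_bounds (c := c) (C := C)
    (φ := fun n θ => dirichletWeight α θ * (expScaled H n θ * Real.exp (-(n * h))))
    hα hH.mem_simplex hc hC hr
    (Eventually.of_forall fun n => ((measurable_dirichletWeight α).aemeasurable.mul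
      ((hH.aemeasurable_expScaled n).mul_const _)).aestronglyMeasurable)
    (by
      filter_upwards [eventually_ge_atTop 0] with n hn
      filter_upwards [ae_mem_stdSimplex d] with θ hθ
      have hw := dirichletWeight_nonneg (α := α) hθ.1
      have he := expScaled_nonneg H n θ
      refine ⟨by positivity, mul_le_mul_of_nonneg_left ?_ hw⟩
      have := mul_le_mul_of_nonneg_right (hup n hn θ hθ) (Real.exp_pos (-(n * h))).le
      rwa [mul_right_comm, hexp, one_mul] at this)
    (by
      filter_upwards [eventually_ge_atTop 0] with n hn
      filter_upwards [ae_mem_stdSimplex d] with θ hθ hθr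
      refine mul_le_mul_of_nonneg_left ?_ (dirichletWeight_nonneg hθ.1)
      have := mul_le_mul_of_nonneg_right (hlow n hn θ hθr hθ) (Real.exp_pos (-(n * h))).le
      rwa [mul_right_comm, hexp, one_mul] at this)
  have hB := multiBeta_pos hα
  refine ⟨1 / multiBeta α * a, 1 / multiBeta α * b, by positivity, by positivity, ?_⟩
  filter_upwards [hev] with n ⟨h1, h2, h3⟩
  have hfun : (fun θ => dirichletDensity α θ * expScaled H n θ) = fun θ =>
      (1 / multiBeta α * Real.exp (n * h)) *
        (dirichletWeight α θ * (expScaled H n θ * Real.exp (-(n * h)))) := by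
    ext θ
    rw [dirichletDensity_eq]
    linear_combination (-(1 / multiBeta α * dirichletWeight α θ * expScaled H n θ)) * hexp n
  have hI : estimand H α n = (1 / multiBeta α * Real.exp (n * h)) *
      ∫ θ, dirichletWeight α θ * (expScaled H n θ * Real.exp (-(n * h)))
        ∂(simplexMeasure d) := by
    rw [estimand, integral_dirichletMeasure hα, hfun, integral_const_mul]
  have hp : 0 ≤ 1 / multiBeta α * Real.exp (n * h) := by positivity
  refine ⟨hfun ▸ h1.const_mul _, ?_, ?_⟩
  · rw [hI]
    calc _ = (1 / multiBeta α * Real.exp (n * h)) * (a * n ^ (-laplaceRate α θs)) := by ring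
      _ ≤ _ := mul_le_mul_of_nonneg_left h2 hp
  · rw [hI]
    calc _ ≤ (1 / multiBeta α * Real.exp (n * h)) * (b * n ^ (-laplaceRate α θs)) :=
          mul_le_mul_of_nonneg_left h3 hp
      _ = _ := by ring

theorem aemeasurable_isReplication (hH : LaplaceAssumptions H θs) (ε γ n : ℝ) :
    AEMeasurable (isReplication H α θs ε γ n) (simplexMeasure d) := by
  classical
  refine ((hH.aemeasurable_expScaled n).mul ((measurable_dirichletDensity α).div
    (measurable_dirichletDensity _)).aemeasurable).mul (Measurable.aemeasurable ?_)
  exact Measurable.ite (measurableSet_truncatedSimplex θs ε) measurable_const measurable_const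

theorem dirichletWeight_pos {θ : Fin (d + 1) → ℝ} (hθ : ∀ i, 0 < θ i) :
    0 < dirichletWeight α θ := Finset.prod_pos fun i _ => Real.rpow_pos_of_pos (hθ i) _

theorem dirichletDensity_pos {θ : Fin (d + 1) → ℝ} (hα : ∀ i, 0 < α i) (hθ : ∀ i, 0 < θ i) :
    0 < dirichletDensity α θ :=
  mul_pos (one_div_pos.2 (multiBeta_pos hα)) (dirichletWeight_pos hθ)

/-- The importance sampling replication is nonnegative with mean at most the estimand. -/
theorem integral_isReplication_bounds (hd : 1 ≤ d) (hH : LaplaceAssumptions H θs)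
    (hα : ∀ i, 0 < α i) (ε γ : ℝ) {n : ℝ} (hn : 0 ≤ n)
    (hint : Integrable (fun θ => dirichletDensity α θ * expScaled H n θ) (simplexMeasure d)) :
    0 ≤ ∫ θ, isReplication H α θs ε γ n θ ∂(dirichletMeasure (isParam α θs γ n)) ∧
      ∫ θ, isReplication H α θs ε γ n θ ∂(dirichletMeasure (isParam α θs γ n)) ≤
        estimand H α n := by
  have hβ := isParam_pos (γ := γ) hα hH.mem_simplex.1 hn
  have key : ∀ᵐ θ ∂(simplexMeasure d),
      0 ≤ dirichletDensity (isParam α θs γ n) θ * isReplication H α θs ε γ n θ ∧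
      dirichletDensity (isParam α θs γ n) θ * isReplication H α θs ε γ n θ ≤
        dirichletDensity α θ * expScaled H n θ := by
    filter_upwards [ae_simplexCoord_pos hd] with θ hθ
    have h1 := dirichletDensity_pos hβ hθ
    have h2 := dirichletDensity_pos hα hθ
    have h3 := expScaled_nonneg H n θ
    unfold isReplication
    split_ifs
    · refine ⟨by positivity, le_of_eq ?_⟩
      field_simp
    · simp only [mul_zero]
      exact ⟨le_rfl, by positivity⟩
  rw [integral_dirichletMeasure hβ, estimand, integral_dirichletMeasure hα]
  exact ⟨integral_nonneg_of_ae (key.mono fun θ h => h.1),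
    integral_mono_of_nonneg (key.mono fun θ h => h.1) hint (key.mono fun θ h => h.2)⟩

/-- Laplace asymptotics of the second moment of a replication. -/
theorem exists_secondMoment_bounds (hd : 1 ≤ d) (hH : LaplaceAssumptions H θs)
    (hα : ∀ i, 0 < α i) {ε : ℝ} (hε : 0 < ε) (hεθ : ∀ i, 0 < θs i → ε < θs i)
    {γ : ℝ} (hγ : γ ∈ Set.Ioo (0 : ℝ) 1)
    (hprob : ∀ n : ℝ, 0 < n → IsProbabilityMeasure (dirichletMeasure (isParam α θs γ n))) :
    ∃ a b, 0 < a ∧ 0 < b ∧ ∀ᶠ n in atTop,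
      Integrable (fun θ => isReplication H α θs ε γ n θ ^ 2)
        (dirichletMeasure (isParam α θs γ n)) ∧
      a * ((n ^ γ) ^ (-laplaceRate α θs) *
        (Real.exp (n * (H θs).toReal) ^ 2 * n ^ (-laplaceRate α θs))) ≤
        ∫ θ, isReplication H α θs ε γ n θ ^ 2 ∂(dirichletMeasure (isParam α θs γ n)) ∧
      ∫ θ, isReplication H α θs ε γ n θ ^ 2 ∂(dirichletMeasure (isParam α θs γ n)) ≤
        b * ((n ^ γ) ^ (-laplaceRate α θs) *
        (Real.exp (n * (H θs).toReal) ^ 2 * n ^ (-laplaceRate α θs))) := by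
  classical
  obtain ⟨c, hc, hup⟩ := hH.exists_expScaled_le
  obtain ⟨C, r₁, hC, hr₁, hlow⟩ := hH.exists_le_expScaled
  obtain ⟨r₂, hr₂, hball⟩ := exists_ball_subset_truncated hεθ
  obtain ⟨a₁, b₁, ha₁, hb₁, hZ⟩ := exists_integral_entropy_bounds hd hα hH.mem_simplex
  set h := (H θs).toReal
  set D := max 1 (1 / ε)
  have hD : 0 < D := by positivity
  have hexp : ∀ n : ℝ, Real.exp (n * h) * Real.exp (-(n * h)) = 1 := fun n => by
    rw [← Real.exp_add]; simp
  -- The use of `γ < 1`: of the decay `2 * c * n` per unit gap from the squared likelihood, the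
  -- reciprocal density costs at most half.
  have hsmall : ∀ᶠ n : ℝ in atTop, D * n ^ γ ≤ c * n := by
    filter_upwards [(tendsto_rpow_atTop (sub_pos.2 hγ.2)).eventually_ge_atTop (D / c),
      eventually_gt_atTop 0] with n h1 h2
    rw [div_le_iff₀ hc] at h1
    calc D * n ^ γ ≤ n ^ (1 - γ) * c * n ^ γ := by gcongr
      _ = c * (n ^ (1 - γ) * n ^ γ) := by ring
      _ = c * n := by rw [← Real.rpow_add h2, sub_add_cancel, Real.rpow_one]
  set φ : ℝ → (Fin (d + 1) → ℝ) → ℝ := fun n θ => dirichletWeight α θ *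
    ((expScaled H n θ * Real.exp (-(n * h))) ^ 2 * Real.exp (n ^ γ * simplexEntropy θs θ) *
      (if θ ∈ truncatedSimplex θs ε then 1 else 0)) with hφ
  have hM : Measurable (simplexEntropy θs) := by unfold simplexEntropy; fun_prop
  -- The constant `c` is what `hsmall` leaves of `2 * c`. For the lower bound the entropy factor is
  -- at least `1` and is dropped, and squaring doubles `C`.
  obtain ⟨a₂, b₂, ha₂, hb₂, hev⟩ := exists_integral_laplace_bounds (c := c) (C := 2 * C) (φ := φ)
    hα hH.mem_simplex hc (by positivity) (lt_min hr₁ hr₂)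
    (Eventually.of_forall fun n => by
      refine AEMeasurable.aestronglyMeasurable ?_
      refine (measurable_dirichletWeight α).aemeasurable.mul ?_
      refine ((((hH.aemeasurable_expScaled n).mul_const _).pow_const 2).mul
        (hM.const_mul _).exp.aemeasurable).mul (Measurable.aemeasurable ?_)
      exact Measurable.ite (measurableSet_truncatedSimplex θs ε) measurable_const
        measurable_const)
    (by
      filter_upwards [eventually_ge_atTop 0, hsmall] with n hn hs
      filter_upwards [ae_mem_stdSimplex d, ae_simplexCoord_pos hd] with θ hθ hpos
      have hw := dirichletWeight_nonneg (α := α) hθ.1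
      have he := expScaled_nonneg H n θ
      have hg := simplexGap_nonneg (θs := θs) hθ.1
      by_cases hT : θ ∈ truncatedSimplex θs ε
      · simp only [hφ, hT, if_true, mul_one]
        refine ⟨by positivity, mul_le_mul_of_nonneg_left ?_ hw⟩
        have h1 := mul_le_mul_of_nonneg_right (hup n hn θ hθ) (Real.exp_pos (-(n * h))).le
        rw [mul_right_comm, hexp, one_mul] at h1
        have h2 := simplexEntropy_le hε hH.mem_simplex hT hpos
        have hnγ := Real.rpow_nonneg hn γ
        calc _ ≤ Real.exp (-(c * n * simplexGap θs θ)) ^ 2 *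
              Real.exp (n ^ γ * (D * simplexGap θs θ)) := by gcongr
          _ = Real.exp (-(2 * (c * n * simplexGap θs θ)) + n ^ γ * (D * simplexGap θs θ)) := by
              rw [← Real.exp_nat_mul, ← Real.exp_add]
              congr 1; push_cast; ring
          _ ≤ _ := by
              refine Real.exp_le_exp.2 ?_
              have := mul_le_mul_of_nonneg_right hs hg
              linarith
      · simp only [hφ, hT, if_false, mul_zero]
        exact ⟨le_rfl, by positivity⟩)
    (by
      filter_upwards [eventually_ge_atTop 0] with n hn
      filter_upwards [ae_mem_stdSimplex d, ae_simplexCoord_pos hd] with θ hθ hpos hθr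
      have hT := hball θ (Metric.ball_subset_ball (min_le_right _ _) hθr) hθ
      simp only [hφ, hT, if_true, mul_one]
      refine mul_le_mul_of_nonneg_left ?_ (dirichletWeight_nonneg hθ.1)
      have h1 := mul_le_mul_of_nonneg_right
        (hlow n hn θ (Metric.ball_subset_ball (min_le_left _ _) hθr) hθ)
        (Real.exp_pos (-(n * h))).le
      rw [mul_right_comm, hexp, one_mul] at h1
      have hg := simplexGap_nonneg (θs := θs) hθ.1
      have h2 := simplexEntropy_ge hH.mem_simplex hθ hpos
      have hnγ := Real.rpow_nonneg hn γ
      have h3 : 1 ≤ Real.exp (n ^ γ * simplexEntropy θs θ) :=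
        Real.one_le_exp (mul_nonneg hnγ (by linarith))
      calc _ = Real.exp (-(C * n * simplexGap θs θ)) ^ 2 * 1 := by
            rw [← Real.exp_nat_mul, mul_one]
            congr 1; push_cast; ring
        _ ≤ _ := by gcongr)
  have hB := multiBeta_pos hα
  refine ⟨1 / multiBeta α ^ 2 * (a₁ * a₂), 1 / multiBeta α ^ 2 * (b₁ * b₂), by positivity,
    by positivity, ?_⟩
  filter_upwards [hev, (tendsto_rpow_atTop hγ.1).eventually hZ, eventually_gt_atTop 0]
    with n ⟨h1, h2, h3⟩ ⟨z1, z2⟩ hn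
  have := hprob n hn
  have hβ := isParam_pos (γ := γ) hα hH.mem_simplex.1 hn.le
  have hBβ := multiBeta_isParam hd hβ
  set Z := ∫ θ, dirichletWeight α θ * Real.exp (-(n ^ γ * simplexEntropy θs θ))
    ∂(simplexMeasure d) with hZdef
  have hnκ : 0 < n ^ (-laplaceRate α θs) := Real.rpow_pos_of_pos hn _
  have hnγκ : 0 < (n ^ γ) ^ (-laplaceRate α θs) :=
    Real.rpow_pos_of_pos (Real.rpow_pos_of_pos hn _) _
  have hZ0 : 0 < Z := lt_of_lt_of_le (by positivity) z1
  -- The factor left after the cancellation of prefactors; it also restores the maximum of the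
  -- squared likelihood, divided out of `φ`.
  set K := 1 / multiBeta α ^ 2 * Z * Real.exp (n * h) ^ 2 with hK
  have hfun : (fun θ => dirichletDensity (isParam α θs γ n) θ *
      isReplication H α θs ε γ n θ ^ 2) =ᵐ[simplexMeasure d] fun θ => K * φ n θ := by
    filter_upwards [ae_simplexCoord_pos hd] with θ hpos
    have hw := dirichletWeight_pos (α := α) hpos
    have hwβ : dirichletWeight (isParam α θs γ n) θ = _ :=
      dirichletWeight_add_mul α θs θ (n ^ γ) hpos
    simp only [isReplication, hφ, hK, dirichletDensity_eq, hwβ, hBβ]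
    split_ifs
    · rw [Real.exp_neg, Real.exp_neg]
      field_simp
    · simp
  have hint : ∫ θ, isReplication H α θs ε γ n θ ^ 2 ∂(dirichletMeasure (isParam α θs γ n)) =
      K * ∫ θ, φ n θ ∂(simplexMeasure d) := by
    rw [integral_dirichletMeasure hβ, integral_congr_ae hfun, integral_const_mul]
  refine ⟨(integrable_dirichletMeasure_iff hβ _).2 ((h1.const_mul K).congr hfun.symm), ?_, ?_⟩
  · rw [hint]
    calc _ = 1 / multiBeta α ^ 2 * (a₁ * (n ^ γ) ^ (-laplaceRate α θs)) * Real.exp (n * h) ^ 2 *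
          (a₂ * n ^ (-laplaceRate α θs)) := by ring
      _ ≤ _ := by rw [hK]; gcongr
  · rw [hint]
    have h0 : 0 ≤ ∫ θ, φ n θ ∂(simplexMeasure d) := le_trans (by positivity) h2
    calc _ ≤ 1 / multiBeta α ^ 2 * (b₁ * (n ^ γ) ^ (-laplaceRate α θs)) * Real.exp (n * h) ^ 2 *
          (b₂ * n ^ (-laplaceRate α θs)) := by rw [hK]; gcongr
      _ = _ := by ring

end Rates

/-! ### Bias, variance and the relative error -/

/-- Mean squared error of a sample mean of nonnegative-mean replications whose mean does not exceed
the target. -/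
theorem meanSquaredError_sampleMean_bounds {Ω E : Type*} [MeasurableSpace Ω] [MeasurableSpace E]
    {P : Measure Ω} [IsProbabilityMeasure P] {ν : Measure E} {N : ℕ} (hN : 1 ≤ N)
    {X : Fin N → Ω → E} (hlaw : ∀ i, HasLaw (X i) ν P) (hindep : iIndepFun X P) {r : E → ℝ}
    (hr : AEMeasurable r ν) (hr2 : Integrable (fun x => r x ^ 2) ν) {I : ℝ}
    (h0 : 0 ≤ ∫ x, r x ∂ν) (hI : ∫ x, r x ∂ν ≤ I) :
    (∫ x, r x ^ 2 ∂ν - I ^ 2) / N ≤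
        meanSquaredError P (fun ω => 1 / (N : ℝ) * ∑ i, r (X i ω)) I ∧
      meanSquaredError P (fun ω => 1 / (N : ℝ) * ∑ i, r (X i ω)) I ≤
        ∫ x, r x ^ 2 ∂ν + I ^ 2 := by
  have hN' : (1 : ℝ) ≤ N := by exact_mod_cast hN
  set m := ∫ x, r x ∂ν with hm
  set q := ∫ x, r x ^ 2 ∂ν with hq
  have hrmap : ∀ i, AEMeasurable r (P.map (X i)) := fun i => (hlaw i).map_eq ▸ hr
  have hYm : ∀ i, AEMeasurable (r ∘ X i) P := fun i =>
    (hrmap i).comp_aemeasurable (hlaw i).aemeasurable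
  have hYL : ∀ i, MemLp (r ∘ X i) 2 P := fun i => by
    rw [memLp_two_iff_integrable_sq (hYm i).aestronglyMeasurable]
    have : Integrable (fun x => r x ^ 2) (P.map (X i)) := by rwa [(hlaw i).map_eq]
    exact this.comp_aemeasurable (hlaw i).aemeasurable
  have hEY : ∀ i, ∫ ω, (r ∘ X i) ω ∂P = m := fun i =>
    (hlaw i).integral_comp hr.aestronglyMeasurable
  have hEY2 : ∀ i, ∫ ω, ((r ∘ X i) ^ 2) ω ∂P = q := fun i =>
    (hlaw i).integral_comp hr2.aestronglyMeasurable
  have hVY : ∀ i, variance (r ∘ X i) P = q - m ^ 2 := fun i => by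
    rw [variance_eq_sub (hYL i), hEY2, hEY]
  have hS : variance (∑ i, r ∘ X i) P = N * (q - m ^ 2) := by
    rw [IndepFun.variance_sum (fun i _ => hYL i)
      (fun i _ j _ hij => (hindep.comp₀ _ (fun i => (hlaw i).aemeasurable) hrmap).indepFun hij)]
    simp [hVY, mul_sub]
  set Z : Ω → ℝ := fun ω => 1 / (N : ℝ) * ∑ i, r (X i ω) with hZ
  have hZe : Z = fun ω => 1 / (N : ℝ) * (∑ i, r ∘ X i) ω := by
    ext ω; simp [hZ, Finset.sum_apply]
  have hZL : MemLp Z 2 P := by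
    rw [hZe]; exact (memLp_finsetSum' _ fun i _ => hYL i).const_mul _
  have hVZ : variance Z P = (q - m ^ 2) / N := by
    rw [hZe, variance_const_mul, hS]
    field_simp
  have hEZ : ∫ ω, Z ω ∂P = m := by
    rw [hZ, integral_const_mul, integral_finsetSum _ fun i _ =>
      show Integrable (fun ω => r (X i ω)) P from (hYL i).integrable (by norm_num)]
    have : ∀ i, ∫ ω, r (X i ω) ∂P = m := hEY
    simp only [this, Finset.sum_const, Finset.card_univ, Fintype.card_fin, nsmul_eq_mul]
    field_simp
  have hMSE : meanSquaredError P Z I = (q - m ^ 2) / N + (m - I) ^ 2 := by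
    have hL : MemLp (fun ω => Z ω - I) 2 P := hZL.sub (memLp_const I)
    have h1 := variance_eq_sub hL
    rw [variance_sub_const hZL.aestronglyMeasurable, hVZ] at h1
    have h2 : ∫ ω, (Z ω - I) ∂P = m - I := by
      rw [integral_sub (hZL.integrable (by norm_num)) (integrable_const I), hEZ]
      simp
    rw [h2] at h1
    have h3 : meanSquaredError P Z I = ∫ ω, ((fun ω => Z ω - I) ^ 2) ω ∂P := rfl
    rw [h3]; linarith
  have hv : 0 ≤ q - m ^ 2 := by
    rw [← hVY ⟨0, hN⟩]; exact variance_nonneg _ _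
  rw [hMSE]
  -- Below, the squared bias is dropped and `m² ≤ I²`; above, `(m - I)² - m² ≤ I²` because `m * I ≥
  -- 0`.
  constructor
  · have : (q - I ^ 2) / N ≤ (q - m ^ 2) / N := by gcongr
    nlinarith [sq_nonneg (m - I)]
  · have : (q - m ^ 2) / N ≤ q - m ^ 2 := div_le_self hv hN'
    nlinarith

end

theorem exists_relative_mse_bounds {d : ℕ} (hd : 1 ≤ d)
    {H : (Fin (d + 1) → ℝ) → EReal} {θs : Fin (d + 1) → ℝ} (hH : LaplaceAssumptions H θs)
    {α : Fin (d + 1) → ℝ} (hα : ∀ i, 0 < α i)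
    {ε : ℝ} (hε : 0 < ε) (hεθ : ∀ i, 0 < θs i → ε < θs i) {N : ℕ} (hN : 1 ≤ N)
    {Ω : Type*} [MeasurableSpace Ω] {P : Measure Ω} [IsProbabilityMeasure P]
    {γ : ℝ} (hγ : γ ∈ Set.Ioo (0 : ℝ) 1) {X : ℝ → Fin N → Ω → (Fin (d + 1) → ℝ)}
    (hlaw : ∀ n : ℝ, 0 < n → ∀ i, HasLaw (X n i) (dirichletMeasure (isParam α θs γ n)) P)
    (hindep : ∀ n : ℝ, 0 < n → iIndepFun (X n) P) :
    ∃ a b, 0 < a ∧ 0 < b ∧ ∀ᶠ n in atTop,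
      a * n ^ ((1 - γ) * laplaceRate α θs) ≤
        meanSquaredError P (fun ω => isEstimator H α θs ε γ n (fun i => X n i ω))
          (estimand H α n) / estimand H α n ^ 2 ∧
      meanSquaredError P (fun ω => isEstimator H α θs ε γ n (fun i => X n i ω))
          (estimand H α n) / estimand H α n ^ 2 ≤ b * n ^ ((1 - γ) * laplaceRate α θs) := by
  -- Total mass one is inherited from the law of the sample, so the Dirichlet integral need not be
  -- evaluated.
  have hprob : ∀ n : ℝ, 0 < n → IsProbabilityMeasure (dirichletMeasure (isParam α θs γ n)) :=
    fun n hn => (hlaw n hn ⟨0, hN⟩).isProbabilityMeasure_iff.1 inferInstance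
  obtain ⟨a₁, b₁, ha₁, hb₁, hI⟩ := exists_estimand_bounds hH hα
  obtain ⟨a₂, b₂, ha₂, hb₂, hM⟩ := exists_secondMoment_bounds hd hH hα hε hεθ hγ hprob
  have hκ := laplaceRate_pos hd α θs hα hH.mem_simplex
  have hN' : (1 : ℝ) ≤ N := by exact_mod_cast hN
  have hrate : 0 < (1 - γ) * laplaceRate α θs := mul_pos (sub_pos.2 hγ.2) hκ
  -- The factor `2` pays for subtracting `I²`, eventually at most half the lower bound on the second
  -- moment; the `+ 1` pays for adding `I²`, once the rate exceeds `1`.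
  refine ⟨a₂ / (2 * b₁ ^ 2 * N), b₂ / a₁ ^ 2 + 1, by positivity, by positivity, ?_⟩
  filter_upwards [hI, hM, eventually_gt_atTop 0,
    (tendsto_rpow_atTop hrate).eventually_ge_atTop 1,
    (tendsto_rpow_atTop hrate).eventually_ge_atTop (2 * b₁ ^ 2 / a₂)]
    with n ⟨hint, i1, i2⟩ ⟨hint2, m1, m2⟩ hn hT1 hT2
  have hβ := isParam_pos (γ := γ) hα hH.mem_simplex.1 hn.le
  have hr : AEMeasurable (isReplication H α θs ε γ n) (dirichletMeasure (isParam α θs γ n)) := by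
    rw [dirichletMeasure_eq_withDensity]
    exact (aemeasurable_isReplication hH ε γ n).mono_ac (withDensity_absolutelyContinuous _ _)
  obtain ⟨k0, k1⟩ := integral_isReplication_bounds hd hH hα ε γ hn.le hint
  obtain ⟨e1, e2⟩ := meanSquaredError_sampleMean_bounds hN (hlaw n hn) (hindep n hn) hr hint2 k0 k1
  have hEst : (fun ω => isEstimator H α θs ε γ n fun i => X n i ω) =
      fun ω => 1 / (N : ℝ) * ∑ i, isReplication H α θs ε γ n (X n i ω) := rfl
  rw [hEst]
  set T := n ^ ((1 - γ) * laplaceRate α θs)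
  set I := estimand H α n
  set q := ∫ θ, isReplication H α θs ε γ n θ ^ 2 ∂(dirichletMeasure (isParam α θs γ n))
  set Y := Real.exp (n * (H θs).toReal) * n ^ (-laplaceRate α θs) with hY
  have hY0 : 0 < Y := mul_pos (Real.exp_pos _) (Real.rpow_pos_of_pos hn _)
  have hpow : (n ^ γ) ^ (-laplaceRate α θs) *
      (Real.exp (n * (H θs).toReal) ^ 2 * n ^ (-laplaceRate α θs)) = T * Y ^ 2 := by
    have h1 : (n ^ γ) ^ (-laplaceRate α θs) = T * n ^ (-laplaceRate α θs) := by
      rw [← Real.rpow_mul hn.le, ← Real.rpow_add hn]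
      congr 1; ring
    rw [h1, hY]; ring
  rw [hpow] at m1 m2
  have hI0 : 0 < I := lt_of_lt_of_le (by positivity) i1
  have hI1 : a₁ ^ 2 * Y ^ 2 ≤ I ^ 2 := by rw [← mul_pow]; gcongr
  have hI2 : I ^ 2 ≤ b₁ ^ 2 * Y ^ 2 := by rw [← mul_pow]; gcongr
  constructor
  · rw [le_div_iff₀ (by positivity)]
    refine le_trans ?_ e1
    rw [le_div_iff₀ (by positivity)]
    rw [div_le_iff₀ ha₂] at hT2
    have h1 : a₂ / (2 * b₁ ^ 2 * N) * T * I ^ 2 * N ≤ a₂ / 2 * T * Y ^ 2 := by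
      calc _ ≤ a₂ / (2 * b₁ ^ 2 * N) * T * (b₁ ^ 2 * Y ^ 2) * N := by gcongr
        _ = _ := by field_simp
    have h2 : b₁ ^ 2 * Y ^ 2 ≤ a₂ / 2 * T * Y ^ 2 := by
      gcongr; linarith
    linarith
  · rw [div_le_iff₀ (by positivity)]
    refine e2.trans ?_
    have h1 : q ≤ b₂ / a₁ ^ 2 * T * I ^ 2 := by
      calc q ≤ b₂ * (T * Y ^ 2) := m2
        _ = b₂ / a₁ ^ 2 * T * (a₁ ^ 2 * Y ^ 2) := by field_simp
        _ ≤ _ := by gcongr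
    have h2 : I ^ 2 ≤ T * I ^ 2 := le_mul_of_one_le_left (by positivity) hT1
    linarith

theorem mainTheorem5 {d : ℕ} (hd : 1 ≤ d)
    (H : (Fin (d + 1) → ℝ) → EReal) (θs : Fin (d + 1) → ℝ) (hH : LaplaceAssumptions H θs)
    (α : Fin (d + 1) → ℝ) (hα : ∀ i, 0 < α i)
    (ε : ℝ) (hε : 0 < ε) (hεθ : ∀ i, 0 < θs i → ε < θs i)
    {N : ℕ} (hN : 1 ≤ N)
    {Ω : Type*} [MeasurableSpace Ω] (P : Measure Ω) [IsProbabilityMeasure P]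
    (X : ℝ → ℝ → Fin N → Ω → (Fin (d + 1) → ℝ))
    (hX_law : ∀ γ ∈ Set.Ioo (0 : ℝ) 1, ∀ n : ℝ, 0 < n → ∀ i,
      HasLaw (X γ n i) (dirichletMeasure (isParam α θs γ n)) P)
    (hX_indep : ∀ γ ∈ Set.Ioo (0 : ℝ) 1, ∀ n : ℝ, 0 < n → iIndepFun (X γ n) P) :
    (∀ γ ∈ Set.Ioo (0 : ℝ) 1,
      (fun n : ℝ =>
        meanSquaredError P (fun ω => isEstimator H α θs ε γ n (fun i => X γ n i ω))
          (estimand H α n) / estimand H α n ^ 2)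
      =Θ[atTop]
      (fun n : ℝ => n ^ ((1 - γ) * (((d : ℝ) - numZeros θs) / 2 + zeroParamSum α θs)))) ∧
    (∀ ξ : ℝ, 0 < ξ → ∃ γ₀ ∈ Set.Ioo (0 : ℝ) 1, ∀ γ ∈ Set.Ico γ₀ 1,
      (fun n : ℝ =>
        meanSquaredError P (fun ω => isEstimator H α θs ε γ n (fun i => X γ n i ω))
          (estimand H α n) / estimand H α n ^ 2)
      =O[atTop]
      (fun n : ℝ => n ^ ξ)) := by
  have hΘ : ∀ γ ∈ Set.Ioo (0 : ℝ) 1,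
      (fun n : ℝ =>
        meanSquaredError P (fun ω => isEstimator H α θs ε γ n (fun i => X γ n i ω))
          (estimand H α n) / estimand H α n ^ 2)
      =Θ[atTop] (fun n : ℝ => n ^ ((1 - γ) * laplaceRate α θs)) := by
    intro γ hγ
    obtain ⟨a, b, ha, hb, h⟩ := exists_relative_mse_bounds hd hH hα hε hεθ hN hγ
      (hX_law γ hγ) (hX_indep γ hγ)
    refine ⟨IsBigO.of_bound b ?_, IsBigO.of_bound a⁻¹ ?_⟩
    all_goals
      filter_upwards [h, eventually_gt_atTop 0] with n ⟨h1, h2⟩ hn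
      have hp : 0 < n ^ ((1 - γ) * laplaceRate α θs) := Real.rpow_pos_of_pos hn _
      rw [Real.norm_of_nonneg hp.le, Real.norm_of_nonneg (le_trans (by positivity) h1)]
    · exact h2
    · rwa [inv_mul_eq_div, le_div_iff₀' ha]
  refine ⟨hΘ, fun ξ hξ => ?_⟩
  have hκ := laplaceRate_pos hd α θs hα hH.mem_simplex
  -- The second entry is the solution of `(1 - γ) * κ = ξ`; the first only keeps `γ₀` positive when
  -- `ξ` is large.
  refine ⟨max (1 / 2) (1 - ξ / laplaceRate α θs), ⟨by positivity, max_lt (by norm_num) ?_⟩,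
    fun γ hγ => ?_⟩
  · have : 0 < ξ / laplaceRate α θs := by positivity
    linarith
  have hγ0 : 1 / 2 ≤ γ := (le_max_left _ _).trans hγ.1
  have hγ1 : 1 - ξ / laplaceRate α θs ≤ γ := (le_max_right _ _).trans hγ.1
  refine (hΘ γ ⟨by linarith, hγ.2⟩).1.trans (IsBigO.of_bound 1 ?_)
  filter_upwards [eventually_ge_atTop 1] with n hn
  have hn0 : 0 ≤ n := by linarith
  rw [Real.norm_of_nonneg (Real.rpow_nonneg hn0 _), Real.norm_of_nonneg (Real.rpow_nonneg hn0 _),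
    one_mul]
  refine Real.rpow_le_rpow_of_exponent_le hn ?_
  rw [← le_div_iff₀ hκ]
  linarith
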